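/- Let $N$ be a free abelian group of rank $n$, $M=\operatorname{Hom}(N,\mathbb Z)$, $M_{\mathbb Q}=\mathbb Q\otimes M$, $N_{\mathbb Q}=\mathbb Q\otimes N$, and let $\Sigma$ be a (finite, non-empty) fan of strongly convex rational polyhedral cones in $N_{\mathbb Q}$, with toric variety $X$. For $\sigma\in\Sigma$ let $\sigma^\perp\subset M_{\mathbb Q}$ be its annihilator, $N_\sigma$ the subgroup of $N$ generated by $\sigma\cap N$, and $N(\sigma)=N/N_\sigma$. Let $Z_*(X)_{\mathbb Q}$ be the $\mathbb Q$-vector space with basis the symbols $[V(\sigma)]$, $\sigma\in\Sigma$ (the classes of the orbit closures), and $[X]=[V(\{0\})]$. A $\mathbb Q$-Cartier divisor $D$ is a collection of local equations $m_\sigma\in M_{\mathbb Q}/\sigma^\perp$ ($\sigma\in\Sigma$) such that $m_\sigma\mapsto m_\tau$ under $M_{\mathbb Q}/\sigma^\perp\to M_{\mathbb Q}/\tau^\perp$ whenever $\tau$ is a face of $\sigma$. Let $0=L_0\subset L_1\subset\dots\subset L_n=M_{\mathbb Q}$ be a complete flag that is generic with respect to $\Sigma$: $\sigma^\perp\cap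 L_k=0$ for every $k$-dimensional $\sigma\in\Sigma$. For $\sigma\in\Sigma$ of dimension $k$ let $\pi_\sigma:M_{\mathbb Q}\to\sigma^\perp$ be the projection along $L_k$; for $\sigma$ a face of $\tau$ it induces $\pi_\sigma:M_{\mathbb Q}/\tau^\perp\to\sigma^\perp/\tau^\perp$. If $\sigma$ is a facet of $\tau$, let $n_{\tau,\sigma}\in N_\tau/N_\sigma\subset N(\sigma)$ be the first lattice point of $N(\sigma)$ along the ray that is the image of $\tau$. The generic flag action of a $\mathbb Q$-Cartier divisor $D$ with local equations $m_\tau$ on cycles is the linear map with $$D\cdot[V(\sigma)]=\sum_{\tau\in\Sigma:\ \sigma\text{ is a facet of }\tau}\langle\pi_\sigma(m_\tau),n_{\tau,\sigma}\rangle\,[V(\tau)],$$ and $E_1\cdots E_n$ denotes the cycle $E_1\cdot(E_2\cdot(\cdots(E_n\cdot[X])))$. Let $\sigma\in\Sigma$ be an $n$-dimensional simplicial cone with facets $\tau_1,\dots,\tau_n$, and let $E_1,\dots,E_n$ be $\mathbb Q$-Cartier divisors with local equations $m_1,\dots,m_n\in M_{\mathbb Q}$ on $\sigma$. Let $w\in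 N_{\mathbb Q}$ be a non-zero vector perpendicular to $L_{n-1}$. For $1\le i\le n$ pick $t_i\in\tau_i^*=\tau_i^\perp\cap\sigma^\vee$, where $\sigma^\vee\subset M_{\mathbb Q}$ is the dual cone of $\sigma$, such that the lattice volume of the simplex with vertices $0,t_1,\dots,t_n$ is $\frac1{n!}$. (The lattice volume of a simplex with vertices $u_0,\dots,u_n\in M_{\mathbb Q}$ is $\frac1{n!}|\det(\langle u_j-u_0,v_i\rangle)_{i,j}|$, for any basis $v_1,\dots,v_n$ of $N$.) Then $\langle t_i,w\rangle\neq0$ for all $i$, and the coefficient of $[V(\sigma)]$ in $E_1\cdots E_n$ is $$\frac{\langle m_1,w\rangle\cdots\langle m_n,w\rangle}{\langle t_1,w\rangle\cdots\langle t_n,w\rangle}.$$ -/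

import Mathlib

open scoped TensorProduct

noncomputable section

namespace ToricCycles

/-! ### Lattices, cones and fans

`N` is a lattice (a free abelian group of finite rank).  `NQ N` is `ℚ ⊗ N`.  `MQ N` is the rational
dual `ℚ ⊗ Hom(N, ℤ)`, realised as `Hom_ℚ(ℚ ⊗ N, ℚ)`, so that the duality pairing `⟨m, v⟩` is `m v`.
-/

/-- The rational vector space `N_ℚ = ℚ ⊗ N`. -/
abbrev NQ (N : Type*) [AddCommGroup N] : Type _ := ℚ ⊗[ℤ] N

/-- The rational vector space `M_ℚ`, where `M = Hom(N, ℤ)`, as the dual space of `N_ℚ`. -/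
abbrev MQ (N : Type*) [AddCommGroup N] : Type _ := Module.Dual ℚ (NQ N)

/-- Convex cones in `N_ℚ`. -/
abbrev Cone (N : Type*) [AddCommGroup N] : Type _ := PointedCone ℚ (NQ N)

section

variable {N : Type*} [AddCommGroup N]

/-- The linear span of a cone. -/
def linSpan (σ : Cone N) : Submodule ℚ (NQ N) := Submodule.span ℚ (σ : Set (NQ N))

/-- The dimension of a cone. -/
def dim (σ : Cone N) : ℕ := Module.finrank ℚ (linSpan σ)

/-- `σ^⊥ ⊆ M_ℚ`; this is the space `M(σ)` (tensored with `ℚ`). -/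
def perp (σ : Cone N) : Submodule ℚ (MQ N) := (linSpan σ).dualAnnihilator

/-- The dual cone `σ^∨ ⊆ M_ℚ`. -/
def dualCone (σ : Cone N) : PointedCone ℚ (MQ N) :=
  PointedCone.dual (Module.Dual.eval ℚ (NQ N)) (σ : Set (NQ N))

/-- The face `γ^* = γ^⊥ ∩ σ^∨` of the dual cone `σ^∨` attached to a face `γ` of `σ`. -/
def dualFace (σ γ : Cone N) : PointedCone ℚ (MQ N) :=
  PointedCone.ofSubmodule (perp γ) ⊓ dualCone σ

/-- `IsFacet γ σ`: the cone `γ` is a facet, i.e. a maximal proper face, of `σ`. -/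
structure IsFacet (γ σ : Cone N) : Prop where
  isFace : γ.IsFaceOf σ
  ne : γ ≠ σ
  maximal : ∀ δ : Cone N, δ.IsFaceOf σ → γ ≤ δ → δ = γ ∨ δ = σ

lemma linSpan_mono {τ σ : Cone N} (h : τ ≤ σ) : linSpan τ ≤ linSpan σ :=
  Submodule.span_mono h

lemma perp_anti {τ σ : Cone N} (h : τ ≤ σ) : perp σ ≤ perp τ :=
  Submodule.dualAnnihilator_anti (linSpan_mono h)

lemma mem_perp {σ : Cone N} {m : MQ N} : m ∈ perp σ ↔ ∀ v ∈ σ, m v = 0 := by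
  constructor
  · intro h v hv
    exact (Submodule.mem_dualAnnihilator m).1 h v (Submodule.subset_span hv)
  · intro h
    refine (Submodule.mem_dualAnnihilator m).2 fun v hv => ?_
    have : linSpan σ ≤ LinearMap.ker m := Submodule.span_le.2 fun x hx => h x hx
    exact this hv

end

/-- A (finite, non-empty) fan in `N`: a collection of strongly convex rational polyhedral cones in
`N_ℚ`, closed under passing to faces, in which any two cones meet in a common face. -/
structure Fan (N : Type*) [AddCommGroup N] where
  cones : Set (Cone N)
  finite : cones.Finite
  nonempty : cones.Nonempty
  polyhedral : ∀ σ ∈ cones, Submodule.FG σ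
  salient : ∀ σ ∈ cones, (σ : ConvexCone ℚ (NQ N)).Salient
  face_mem : ∀ σ ∈ cones, ∀ τ : Cone N, τ.IsFaceOf σ → τ ∈ cones
  inter_isFace_left : ∀ σ ∈ cones, ∀ τ ∈ cones, (σ ⊓ τ).IsFaceOf σ
  inter_isFace_right : ∀ σ ∈ cones, ∀ τ ∈ cones, (σ ⊓ τ).IsFaceOf τ

section

variable {N : Type*} [AddCommGroup N]

/-- The zero cone belongs to every fan. -/
lemma Fan.bot_mem (Δ : Fan N) : (⊥ : Cone N) ∈ Δ.cones := by
  obtain ⟨σ, hσ⟩ := Δ.nonempty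
  refine Δ.face_mem σ hσ ⊥ ⟨bot_le, ?_⟩
  intro x y a hx hy ha h
  rw [Submodule.mem_bot] at h ⊢
  by_contra hx0
  have hax : a • x ∈ σ := σ.smul_mem ha.le hx
  have hne : a • x ≠ 0 := smul_ne_zero ha.ne' hx0
  refine Δ.salient σ hσ (a • x) hax hne ?_
  rw [neg_eq_of_add_eq_zero_right h]
  exact hy

instance (Δ : Fan N) : Finite Δ.cones := Δ.finite

/-- The group `Z_*(X)_ℚ` of invariant cycles with rational coefficients of the toric variety `X` of
the fan `Δ`: the `ℚ`-vector space with basis the `[V(σ)]`, `σ ∈ Δ`. -/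
abbrev Cycles (Δ : Fan N) : Type _ := Δ.cones →₀ ℚ

/-- The basis element `[V(σ)]`. -/
def V {Δ : Fan N} (σ : Δ.cones) : Cycles Δ := Finsupp.single σ 1

/-- The fundamental cycle `[X] = [V(0)]`. -/
def fundamentalCycle (Δ : Fan N) : Cycles Δ := V ⟨⊥, Δ.bot_mem⟩

/-- A `ℚ`-Cartier divisor, given by its local equations `m_σ ∈ M_σ = M / M(σ)` (tensored with `ℚ`),
which are compatible with restriction to faces. -/
structure QCartierDivisor (Δ : Fan N) where
  localEq : (σ : Δ.cones) → MQ N ⧸ perp (σ : Cone N)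
  agree : ∀ (τ σ : Δ.cones) (h : (τ : Cone N).IsFaceOf (σ : Cone N)),
    Submodule.factor (perp_anti h.le) (localEq σ) = localEq τ

/-! ### The lattices `N_σ`, `N(σ) = N / N_σ`, `N(σ)_τ = N_τ / N_σ` and their pairings -/

/-- The subgroup `N_σ` of `N` generated by `σ ∩ N`. -/
def latticeSpan (σ : Cone N) : Submodule ℤ N :=
  Submodule.span ℤ {v : N | (1 : ℚ) ⊗ₜ[ℤ] v ∈ σ}

/-- The lattice `N(σ) = N / N_σ`. -/
abbrev quotLattice (σ : Cone N) : Type _ := N ⧸ latticeSpan σ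

/-- The image of the cone `τ` in `N(σ)_ℚ`. -/
def imageCone (σ τ : Cone N) : PointedCone ℚ (ℚ ⊗[ℤ] quotLattice σ) :=
  PointedCone.map ((latticeSpan σ).mkQ.baseChange ℚ) τ

/-- The sublattice `N(σ)_τ = N_τ / N_σ` of `N(σ)`. -/
def relLattice (σ τ : Cone N) : Submodule ℤ (quotLattice σ) :=
  (latticeSpan τ).map (latticeSpan σ).mkQ

/-- `x` is the first lattice point of `N(σ)` along the image of `τ` in `N(σ)_ℚ` (which is a ray when
`σ` is a facet of `τ`): a non-zero lattice point on it of which every lattice point on it is a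
multiple. -/
def IsFirstLatticePoint (σ τ : Cone N) (x : relLattice σ τ) : Prop :=
  (1 : ℚ) ⊗ₜ[ℤ] (x : quotLattice σ) ∈ imageCone σ τ ∧ x ≠ 0 ∧
    ∀ y : quotLattice σ, (1 : ℚ) ⊗ₜ[ℤ] y ∈ imageCone σ τ → ∃ k : ℕ, y = k • (x : quotLattice σ)

open Classical in
/-- The vector `n_{τ,σ} ∈ N(σ)_τ`, for `σ` a facet of `τ`.  (The default value `0` is irrelevant: if
`σ` is a facet of a strongly convex rational polyhedral cone `τ`, the first lattice point exists and
is unique.) -/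
def firstLatticePoint (σ τ : Cone N) : relLattice σ τ :=
  if h : ∃ x, IsFirstLatticePoint σ τ x then h.choose else 0

/-- The restriction of an element of `M_ℚ` to a function on the lattice `N`. -/
def onLattice (N : Type*) [AddCommGroup N] : MQ N →ₗ[ℚ] (N →ₗ[ℤ] ℚ) where
  toFun m := (m.restrictScalars ℤ).comp (TensorProduct.mk ℤ ℚ N 1)
  map_add' _ _ := rfl
  map_smul' _ _ := rfl

@[simp] lemma onLattice_apply (m : MQ N) (v : N) : onLattice N m v = m ((1 : ℚ) ⊗ₜ[ℤ] v) := rfl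

lemma perp_onLattice {σ : Cone N} {m : MQ N} (hm : m ∈ perp σ) :
    latticeSpan σ ≤ LinearMap.ker (onLattice N m) :=
  Submodule.span_le.2 fun _ hv => mem_perp.1 hm _ hv

/-- The duality pairing `M(σ) × N(σ) → ℚ`. -/
def pairing (σ : Cone N) : perp σ →ₗ[ℚ] (quotLattice σ →ₗ[ℤ] ℚ) where
  toFun m := (latticeSpan σ).liftQ (onLattice N m) (perp_onLattice m.2)
  map_add' _ _ := by ext v; rfl
  map_smul' _ _ := by ext v; rfl

@[simp] lemma pairing_mk (σ : Cone N) (m : perp σ) (v : N) :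
    pairing σ m (Submodule.Quotient.mk v) = (m : MQ N) ((1 : ℚ) ⊗ₜ[ℤ] v) := rfl

/-- `M(σ)_τ = M(σ) / M(τ)` (tensored with `ℚ`), for `σ` a face of `τ`. -/
abbrev relM (σ τ : Cone N) : Type _ := perp σ ⧸ (perp τ).submoduleOf (perp σ)

/-- The duality pairing `M(σ)_τ × N(σ)_τ → ℚ`, induced by the pairing of `M(σ)` and `N(σ)`. -/
def relPairing (σ τ : Cone N) : relM σ τ →ₗ[ℚ] (relLattice σ τ →ₗ[ℤ] ℚ) :=
  ((perp τ).submoduleOf (perp σ)).liftQ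
    { toFun := fun m => (pairing σ m).comp (relLattice σ τ).subtype
      map_add' := fun _ _ => by ext; simp
      map_smul' := fun _ _ => by ext; simp }
    (by
      intro m hm
      rw [LinearMap.mem_ker]
      ext ⟨x, hx⟩
      obtain ⟨v, hv, rfl⟩ := hx
      exact perp_onLattice (show (m : MQ N) ∈ perp τ from hm) hv)

/-! ### Choices of complements and the action of divisors on cycles -/

/-- A choice of complements for the fan `Δ`. -/
structure ComplementChoice (Δ : Fan N) where
  Ψ : Δ.cones → Submodule ℚ (MQ N)
  isCompl : ∀ σ : Δ.cones, IsCompl (perp (σ : Cone N)) (Ψ σ)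
  strictMono : ∀ τ σ : Δ.cones, (τ : Cone N).IsFaceOf (σ : Cone N) → τ ≠ σ → Ψ τ < Ψ σ

namespace ComplementChoice

variable {Δ : Fan N} (P : ComplementChoice Δ)

/-- The projection `π_σ : M → M(σ)` along `Ψ(σ)`. -/
def proj (σ : Δ.cones) : MQ N →ₗ[ℚ] perp (σ : Cone N) :=
  (perp (σ : Cone N)).projectionOnto (P.Ψ σ) (P.isCompl σ)

/-- The map `π_σ : M_τ = M / M(τ) → M(σ)_τ = M(σ) / M(τ)` induced by `π_σ : M → M(σ)`, for `σ` a
face of `τ`. -/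
def relProj (σ τ : Δ.cones) (h : (σ : Cone N) ≤ τ) :
    (MQ N ⧸ perp (τ : Cone N)) →ₗ[ℚ] relM (σ : Cone N) (τ : Cone N) :=
  Submodule.mapQ _ _ (P.proj σ) (by
    intro m hm
    have h1 : P.proj σ m = ⟨m, perp_anti h hm⟩ :=
      Submodule.projectionOnto_apply_left (P.isCompl σ) ⟨m, perp_anti h hm⟩
    rw [Submodule.mem_comap, h1]
    exact hm)

/-- The number `⟨π_σ(m_τ), n_{τ,σ}⟩`, for `σ` a facet of `τ`. -/
def coeff (D : QCartierDivisor Δ) (σ τ : Δ.cones) (h : (σ : Cone N) ≤ τ) : ℚ :=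
  relPairing (σ : Cone N) τ (P.relProj σ τ h (D.localEq τ)) (firstLatticePoint (σ : Cone N) τ)

open Classical in
/-- The cycle `D · [V(σ)] = ∑ ⟨π_σ(m_τ), n_{τ,σ}⟩ [V(τ)]`, the sum running over the cones `τ ∈ Δ` of
which `σ` is a facet. -/
def actV (D : QCartierDivisor Δ) (σ : Δ.cones) : Cycles Δ :=
  letI := Fintype.ofFinite {τ : Δ.cones // IsFacet (σ : Cone N) (τ : Cone N)}
  ∑ τ : {τ : Δ.cones // IsFacet (σ : Cone N) (τ : Cone N)},
    P.coeff D σ τ.1 τ.2.isFace.le • V τ.1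

/-- The action `z ↦ D · z` of a divisor on cycles, by linear extension. -/
def act (D : QCartierDivisor Δ) : Cycles Δ →ₗ[ℚ] Cycles Δ :=
  Finsupp.linearCombination ℚ (P.actV D)

/-- The cycle `E_1 ⋯ E_k = E_1 · (E_2 · (⋯ (E_k · [X])))`. -/
def prod {k : ℕ} (E : Fin k → QCartierDivisor Δ) : Cycles Δ :=
  (List.ofFn E).foldr (fun D z => P.act D z) (fundamentalCycle Δ)

end ComplementChoice

/-- A proper face of a cone has strictly smaller linear span. -/
lemma linSpan_lt {τ σ : Cone N} (h : τ.IsFaceOf σ) (hne : τ ≠ σ) : linSpan τ < linSpan σ := by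
  refine lt_of_le_of_ne (linSpan_mono h.le) fun heq => hne (le_antisymm h.le fun x hx => ?_)
  have hx' : x ∈ linSpan τ := heq ▸ Submodule.subset_span hx
  have key : ∀ y ∈ linSpan τ, ∃ b ∈ τ, y + b ∈ τ := by
    intro y hy
    induction hy using Submodule.span_induction with
    | mem y hy => exact ⟨0, τ.zero_mem, by simpa using hy⟩
    | zero => exact ⟨0, τ.zero_mem, by simp⟩
    | add y z _ _ hy hz =>
      obtain ⟨b, hb, hb'⟩ := hy
      obtain ⟨c, hc, hc'⟩ := hz
      exact ⟨b + c, τ.add_mem hb hc, by simpa [add_add_add_comm] using τ.add_mem hb' hc'⟩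
    | smul a y _ hy =>
      obtain ⟨b, hb, hb'⟩ := hy
      rcases le_total 0 a with ha | ha
      · refine ⟨a • b, τ.smul_mem ha hb, ?_⟩
        rw [← smul_add]
        exact τ.smul_mem ha hb'
      · have ha' : 0 ≤ -a := neg_nonneg.2 ha
        refine ⟨(-a) • (y + b), τ.smul_mem ha' hb', ?_⟩
        have : a • y + (-a) • (y + b) = (-a) • b := by module
        rw [this]
        exact τ.smul_mem ha' hb
  obtain ⟨b, hb, hb'⟩ := key x hx'
  exact h.mem_of_add_mem_left hx (h.le hb) hb'

end

/-! ### Generic flags -/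

/-- A complete flag `0 = F_0 < F_1 < ⋯ < F_n = W` in a vector space `W` of dimension `n`.  (The
values `F_k` for `k > n` play no role.) -/
structure CompleteFlag (K W : Type*) [Field K] [AddCommGroup W] [Module K W] where
  F : ℕ → Submodule K W
  zero : F 0 = ⊥
  top : F (Module.finrank K W) = ⊤
  lt_succ : ∀ k < Module.finrank K W, F k < F (k + 1)

lemma CompleteFlag.mono {K W : Type*} [Field K] [AddCommGroup W] [Module K W]
    (L : CompleteFlag K W) {j k : ℕ} (hjk : j ≤ k) (hk : k ≤ Module.finrank K W) :
    L.F j ≤ L.F k := by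
  induction k, hjk using Nat.le_induction with
  | base => exact le_rfl
  | succ k _ ih => exact (ih (by omega)).trans (L.lt_succ k (by omega)).le

lemma CompleteFlag.lt {K W : Type*} [Field K] [AddCommGroup W] [Module K W]
    (L : CompleteFlag K W) {j k : ℕ} (hjk : j < k) (hk : k ≤ Module.finrank K W) :
    L.F j < L.F k :=
  (L.lt_succ j (by omega)).trans_le (L.mono hjk hk)

lemma CompleteFlag.finrank_eq {K W : Type*} [Field K] [AddCommGroup W] [Module K W]
    [FiniteDimensional K W] (L : CompleteFlag K W) {k : ℕ} (hk : k ≤ Module.finrank K W) :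
    Module.finrank K (L.F k) = k := by
  have low : ∀ j, j ≤ Module.finrank K W → j ≤ Module.finrank K (L.F j) := by
    intro j
    induction j with
    | zero => intro _; exact Nat.zero_le _
    | succ j ih =>
      intro hj
      have := Submodule.finrank_lt_finrank_of_lt (L.lt_succ j (by omega))
      have := ih (by omega)
      omega
  have up : ∀ d j, j + d = Module.finrank K W → Module.finrank K (L.F j) ≤ j := by
    intro d
    induction d with
    | zero => intro j hj; exact (Submodule.finrank_le _).trans (by omega)
    | succ d ih =>
      intro j hj
      have := Submodule.finrank_lt_finrank_of_lt (L.lt_succ j (by omega))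
      have := ih (j + 1) (by omega)
      omega
  exact le_antisymm (up (Module.finrank K W - k) k (by omega)) (low k hk)

section

variable {N : Type*} [AddCommGroup N]

/-- A complete flag in `M_ℚ` is generic with respect to the fan `Δ` if `σ^⊥ ∩ F_k = 0` for every
`k`-dimensional cone `σ` of `Δ`. -/
def CompleteFlag.IsGeneric (L : CompleteFlag ℚ (MQ N)) (Δ : Fan N) : Prop :=
  ∀ σ ∈ Δ.cones, perp σ ⊓ L.F (dim σ) = ⊥

variable [Module.Finite ℤ N]

lemma dim_le (σ : Cone N) : dim σ ≤ Module.finrank ℚ (MQ N) := by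
  rw [Subspace.dual_finrank_eq]
  exact Submodule.finrank_le _

/-- The choice of complements `Ψ(σ) = F_{dim σ}` given by a generic flag. -/
def CompleteFlag.complements (L : CompleteFlag ℚ (MQ N)) {Δ : Fan N} (hL : L.IsGeneric Δ) :
    ComplementChoice Δ where
  Ψ σ := L.F (dim (σ : Cone N))
  isCompl σ := by
    have hdisj : Disjoint (perp (σ : Cone N)) (L.F (dim (σ : Cone N))) :=
      disjoint_iff.2 (hL σ σ.2)
    refine (Submodule.isCompl_iff_disjoint _ _ ?_).2 hdisj
    rw [L.finrank_eq (dim_le _), Subspace.dual_finrank_eq]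
    have h : dim (σ : Cone N) + Module.finrank ℚ (perp (σ : Cone N)) = Module.finrank ℚ (NQ N) :=
      Subspace.finrank_add_finrank_dualAnnihilator_eq (linSpan (σ : Cone N))
    rw [add_comm, h]
  strictMono τ σ h hne :=
    L.lt (Submodule.finrank_lt_finrank_of_lt
      (linSpan_lt h fun h' => hne (Subtype.ext h'))) (dim_le _)

end

/-! ### Lattice volumes -/

/-- The lattice volume `|det A| / n!` of the simplex in `M_ℚ` with vertices `u_0, …, u_n`, where
`A_{ij} = ⟨u_j - u_0, v_i⟩` for a basis `v_1, …, v_n` of the lattice `N`.  It does not depend on the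
basis, see `latticeVolume_eq`. -/
def latticeVolume {N : Type*} [AddCommGroup N] [Module.Free ℤ N] [Module.Finite ℤ N] {n : ℕ}
    (hn : Module.finrank ℤ N = n) (u : Fin (n + 1) → MQ N) : ℚ :=
  |(Matrix.of fun i j : Fin n =>
    (u j.succ - u 0) ((1 : ℚ) ⊗ₜ[ℤ] (Module.finBasisOfFinrankEq ℤ N hn i))).det| / n.factorial

lemma latticeVolume_eq {N : Type*} [AddCommGroup N] [Module.Free ℤ N] [Module.Finite ℤ N] {n : ℕ}
    (hn : Module.finrank ℤ N = n) (u : Fin (n + 1) → MQ N) (v : Module.Basis (Fin n) ℤ N) :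
    latticeVolume hn u =
      |(Matrix.of fun i j : Fin n => (u j.succ - u 0) ((1 : ℚ) ⊗ₜ[ℤ] v i)).det| / n.factorial := by
  set b := Module.finBasisOfFinrankEq ℤ N hn with hb
  have hmul : (Matrix.of fun i j : Fin n => (u j.succ - u 0) ((1 : ℚ) ⊗ₜ[ℤ] b i)) =
      ((v.toMatrix b).transpose.map (Int.castRingHom ℚ)) *
        (Matrix.of fun i j : Fin n => (u j.succ - u 0) ((1 : ℚ) ⊗ₜ[ℤ] v i)) := by
    ext i j
    have h1 : ∀ m : MQ N, m ((1 : ℚ) ⊗ₜ[ℤ] b i) =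
        ∑ k, ((v.toMatrix b k i : ℤ) : ℚ) * m ((1 : ℚ) ⊗ₜ[ℤ] v k) := by
      intro m
      have h2 := congrArg (onLattice N m) (v.sum_toMatrix_smul_self (⇑b) i)
      rw [map_sum] at h2
      simpa using h2.symm
    simp only [Matrix.of_apply, Matrix.mul_apply, Matrix.map_apply, Matrix.transpose_apply]
    exact h1 _
  have hunit : IsUnit (v.toMatrix b).det := by
    have h := congrArg Matrix.det (v.toMatrix_mul_toMatrix_flip b)
    rw [Matrix.det_mul, Matrix.det_one] at h
    exact IsUnit.of_mul_eq_one _ h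
  have habs : |((v.toMatrix b).transpose.map (Int.castRingHom ℚ)).det| = 1 := by
    have h : ((v.toMatrix b).transpose.map (Int.castRingHom ℚ)).det
        = (((v.toMatrix b).det : ℤ) : ℚ) := by
      rw [← Matrix.det_transpose (v.toMatrix b)]
      exact (RingHom.map_det (Int.castRingHom ℚ) _).symm
    rw [h]
    rcases Int.isUnit_iff.1 hunit with h | h <;> simp [h]
  unfold latticeVolume
  rw [← hb, hmul, Matrix.det_mul, abs_mul, habs, one_mul]

end ToricCycles

end

open ToricCycles

/-! The faces of `σ` correspond to subsets of a basis `v` of `N_ℚ` lying on its rays. The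
coefficient of a face in `D · z` involves only the facets of that face, so it suffices to study
operators on functions on subsets of `Fin n`, weighted by `c J j`, the `v j`-coordinate of the first
lattice point, and by the functionals `m ↦ ⟨π(m), v j⟩`. Any `m : MQ N` defines such an operator,
whether or not it comes from a divisor on the fan; in particular each `t i` does.

These operators commute (`faceAct_comm`). This rests on two symmetries in a pair of removed indices:
of the weights, which compute a covolume in either order (`IsLatticeSystem.mul_comm`), and of the
projections, through a recursion along the flag (`projCoord_exchange`). On the top face the
outermost operator depends on `m` only through `⟨m, w⟩`, because it projects along the hyperplane
`L_{n-1}` (`exists_projCoord_univ`). As any factor can be moved outermost, the coefficient is `K ∏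
⟨m i, w⟩` with `K` independent of the `m i` (`foldr_faceAct_top`).

The constant is found by inserting the `t i`. Each is fixed by the relevant projections and kills
all rays but one, so one chain of faces survives (`foldr_drop_faceAct`). Its contribution is a
triangular determinant equal to `n!` times the lattice volume, that is, `1`. Hence `K ∏ ⟨t i, w⟩ =
1`, which also shows that no `⟨t i, w⟩` vanishes. -/

namespace ToricCycles

/-! ### Faces of a simplicial cone as subsets of a basis. -/

section Faces

variable {N : Type*} [AddCommGroup N] {ι : Type*}

/-- The cone spanned by the members of the basis `v` indexed by `S`. -/
def faceCone (v : Module.Basis ι ℚ (NQ N)) (S : Finset ι) : Cone N where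
  carrier := {x | ∀ i, 0 ≤ v.repr x i ∧ (i ∉ S → v.repr x i = 0)}
  zero_mem' := by simp
  add_mem' := by
    intro x y hx hy i
    refine ⟨?_, fun hi => ?_⟩
    · simpa using add_nonneg (hx i).1 (hy i).1
    · simp [(hx i).2 hi, (hy i).2 hi]
  smul_mem' := by
    intro a x hx i
    have ha : v.repr (a • x) i = (a : ℚ) * v.repr x i := by
      rw [show a • x = (a : ℚ) • x from rfl, map_smul]; rfl
    refine ⟨?_, fun hi => ?_⟩
    · rw [ha]; exact mul_nonneg a.2 (hx i).1
    · rw [ha, (hx i).2 hi, mul_zero]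

variable (v : Module.Basis ι ℚ (NQ N))

lemma mem_faceCone {S : Finset ι} {x : NQ N} :
    x ∈ faceCone v S ↔ ∀ i, 0 ≤ v.repr x i ∧ (i ∉ S → v.repr x i = 0) := Iff.rfl

lemma basis_mem_faceCone {S : Finset ι} {i : ι} : v i ∈ faceCone v S ↔ i ∈ S := by
  classical
  rw [mem_faceCone]
  constructor
  · intro h
    by_contra hi
    simpa using (h i).2 hi
  · intro hi j
    rw [v.repr_self, Finsupp.single_apply]
    split_ifs with h
    · subst h; simp [hi]
    · simp

lemma faceCone_le_iff {S T : Finset ι} : faceCone v S ≤ faceCone v T ↔ S ⊆ T := by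
  constructor
  · exact fun h i hi => (basis_mem_faceCone v).1 (h ((basis_mem_faceCone v).2 hi))
  · exact fun h x hx i => ⟨(hx i).1, fun hi => (hx i).2 fun hi' => hi (h hi')⟩

lemma faceCone_injective : Function.Injective (faceCone v) := fun _ _ h =>
  ((faceCone_le_iff v).1 h.le).antisymm ((faceCone_le_iff v).1 h.ge)

lemma faceCone_empty : faceCone v ∅ = ⊥ := by
  ext x
  rw [mem_faceCone, Submodule.mem_bot]
  constructor
  · intro h
    exact v.repr.map_eq_zero_iff.1 (Finsupp.ext fun i => (h i).2 (by simp))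
  · rintro rfl; simp

lemma isFaceOf_faceCone {S J : Finset ι} (h : S ⊆ J) : (faceCone v S).IsFaceOf (faceCone v J) := by
  refine ⟨(faceCone_le_iff v).2 h, fun {x y a} hx hy ha hxy i => ⟨(hx i).1, fun hi => ?_⟩⟩
  have h1 := (hxy i).2 hi
  simp only [map_add, map_smul, Finsupp.add_apply, Finsupp.smul_apply, smul_eq_mul] at h1
  have h2 := mul_nonneg ha.le (hx i).1
  have h3 : a * v.repr x i = 0 := by linarith [(hy i).1]
  exact (mul_eq_zero.1 h3).resolve_left ha.ne'

lemma eq_sum_of_off_eq_zero [Fintype ι] {S : Finset ι} {x : NQ N}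
    (h : ∀ i ∉ S, v.repr x i = 0) : x = ∑ i ∈ S, v.repr x i • v i := by
  conv_lhs => rw [← v.sum_repr x]
  symm
  apply Finset.sum_subset (Finset.subset_univ _)
  intro i _ hi
  rw [h i hi, zero_smul]

/-- A face is determined by the generators it contains: any generator occurring with positive
coefficient in a point of the face lies in the face. -/
lemma exists_eq_faceCone [Fintype ι] {J : Finset ι} {γ : Cone N}
    (h : γ.IsFaceOf (faceCone v J)) : ∃ S ⊆ J, γ = faceCone v S := by
  classical
  refine ⟨J.filter fun i => v i ∈ γ, Finset.filter_subset _ _, le_antisymm ?_ ?_⟩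
  · intro x hx i
    have hxJ := h.le hx
    refine ⟨(hxJ i).1, fun hi => ?_⟩
    by_contra hne
    have hiJ : i ∈ J := by
      by_contra hiJ
      exact hne ((hxJ i).2 hiJ)
    have hpos : 0 < v.repr x i := lt_of_le_of_ne (hxJ i).1 (Ne.symm hne)
    have hsum : ∑ j : J, v.repr x j • v j ∈ γ := by
      rw [Finset.sum_coe_sort J fun j => v.repr x j • v j,
        ← eq_sum_of_off_eq_zero v fun j hj => (hxJ j).2 hj]
      exact hx
    have := h.mem_of_sum_smul_mem (f := fun j : J => v j)
      (fun j => (basis_mem_faceCone v).2 j.2) (fun j => (hxJ j).1) hsum ⟨i, hiJ⟩ hpos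
    exact hi (Finset.mem_filter.2 ⟨hiJ, this⟩)
  · intro x hx
    rw [eq_sum_of_off_eq_zero v fun j hj => (hx j).2 hj]
    exact Submodule.sum_mem _ fun i hi =>
      γ.smul_mem (hx i).1 (Finset.mem_filter.1 hi).2

lemma isFacet_faceCone_iff [Fintype ι] [DecidableEq ι] {J : Finset ι} {γ : Cone N} :
    IsFacet γ (faceCone v J) ↔ ∃ j ∈ J, γ = faceCone v (J.erase j) := by
  constructor
  · rintro ⟨hface, hne, hmax⟩
    obtain ⟨S, hS, rfl⟩ := exists_eq_faceCone v hface
    have hSJ : S ≠ J := fun h => hne (h ▸ rfl)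
    obtain ⟨j, hj, hjS⟩ := Finset.exists_of_ssubset (hS.ssubset_of_ne hSJ)
    refine ⟨j, hj, ?_⟩
    have hsub : S ⊆ J.erase j := fun i hi =>
      Finset.mem_erase.2 ⟨fun h => hjS (h ▸ hi), hS hi⟩
    rcases hmax _ (isFaceOf_faceCone v (Finset.erase_subset j J))
      ((faceCone_le_iff v).2 hsub) with h | h
    · exact h.symm
    · exact absurd (faceCone_injective v h) (Finset.erase_ssubset hj).ne
  · rintro ⟨j, hj, rfl⟩
    refine ⟨isFaceOf_faceCone v (Finset.erase_subset j J), fun h =>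
      (Finset.erase_ssubset hj).ne (faceCone_injective v h), fun δ hδ hle => ?_⟩
    obtain ⟨T, hT, rfl⟩ := exists_eq_faceCone v hδ
    rw [faceCone_le_iff] at hle
    by_cases hjT : j ∈ T
    · right
      rw [hT.antisymm fun i hi => ?_]
      by_cases hij : i = j
      · exact hij ▸ hjT
      · exact hle (Finset.mem_erase.2 ⟨hij, hi⟩)
    · left
      rw [hle.antisymm fun i hi => Finset.mem_erase.2 ⟨fun h => hjT (h ▸ hi), hT hi⟩]

lemma linSpan_faceCone [Fintype ι] (S : Finset ι) :
    linSpan (faceCone v S) = Submodule.span ℚ (Set.range fun i : S => v i) := by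
  apply le_antisymm
  · refine Submodule.span_le.2 fun x hx => ?_
    rw [eq_sum_of_off_eq_zero v fun j hj => (hx j).2 hj]
    exact Submodule.sum_mem _ fun i hi =>
      Submodule.smul_mem _ _ (Submodule.subset_span ⟨⟨i, hi⟩, rfl⟩)
  · refine Submodule.span_le.2 ?_
    rintro _ ⟨i, rfl⟩
    exact Submodule.subset_span ((basis_mem_faceCone v).2 i.2)

lemma dim_faceCone [Fintype ι] (S : Finset ι) : dim (faceCone v S) = S.card := by
  rw [dim, linSpan_faceCone, ← Fintype.card_coe]
  exact finrank_span_eq_card (v.linearIndependent.comp _ Subtype.val_injective)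

lemma mem_perp_faceCone [Fintype ι] {S : Finset ι} {m : MQ N} :
    m ∈ perp (faceCone v S) ↔ ∀ i ∈ S, m (v i) = 0 := by
  rw [mem_perp]
  constructor
  · exact fun h i hi => h _ ((basis_mem_faceCone v).2 hi)
  · intro h x hx
    rw [eq_sum_of_off_eq_zero v fun j hj => (hx j).2 hj, map_sum]
    exact Finset.sum_eq_zero fun i hi => by rw [map_smul, h i hi, smul_zero]

end Faces

/-! ### Clearing denominators and bases of lattice points on the rays. -/

lemma exists_pos_smul_eq_tmul {N : Type*} [AddCommGroup N] (x : NQ N) :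
    ∃ d : ℚ, 0 < d ∧ ∃ u : N, d • x = (1 : ℚ) ⊗ₜ[ℤ] u := by
  induction x using TensorProduct.induction_on with
  | zero => exact ⟨1, one_pos, 0, by simp⟩
  | tmul q y =>
    refine ⟨q.den, by exact_mod_cast q.den_pos, q.num • y, ?_⟩
    rw [TensorProduct.smul_tmul', TensorProduct.tmul_smul, TensorProduct.smul_tmul']
    congr 1
    simp [Rat.den_mul_eq_num]
  | add x y hx hy =>
    obtain ⟨d, hd, u, hu⟩ := hx
    obtain ⟨e, he, w, hw⟩ := hy
    -- Integral multipliers are needed so that each can also act on the lattice vector of the other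
    -- summand.
    obtain ⟨d', hd', u', hu'⟩ : ∃ d' : ℤ, 0 < d' ∧ ∃ u', (d' : ℚ) • x = (1 : ℚ) ⊗ₜ[ℤ] u' := by
      refine ⟨d.num, Rat.num_pos.2 hd, (d.den : ℤ) • u, ?_⟩
      rw [TensorProduct.tmul_smul, ← hu, ← Int.cast_smul_eq_zsmul ℚ, smul_smul]
      congr 1
      simp [Rat.den_mul_eq_num]
    obtain ⟨e', he', w', hw'⟩ : ∃ d' : ℤ, 0 < d' ∧ ∃ u', (d' : ℚ) • y = (1 : ℚ) ⊗ₜ[ℤ] u' := by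
      refine ⟨e.num, Rat.num_pos.2 he, (e.den : ℤ) • w, ?_⟩
      rw [TensorProduct.tmul_smul, ← hw, ← Int.cast_smul_eq_zsmul ℚ, smul_smul]
      congr 1
      simp [Rat.den_mul_eq_num]
    refine ⟨d' * e', by positivity, e' • u' + d' • w', ?_⟩
    rw [TensorProduct.tmul_add, TensorProduct.tmul_smul, TensorProduct.tmul_smul, ← hu', ← hw',
      ← Int.cast_smul_eq_zsmul ℚ, ← Int.cast_smul_eq_zsmul ℚ]
    module

section Adapted

variable {N : Type*} [AddCommGroup N] [Module.Free ℤ N] [Module.Finite ℤ N] {n : ℕ}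

/-- The generators are rescaled by positive rationals into the lattice. They need not become
primitive; integrality is all that is used later. -/
lemma exists_basis_of_isSimplicial (hn : Module.finrank ℤ N = n) {σ : Cone N} (hdim : dim σ = n)
    (hsimp : σ.IsSimplicial) :
    ∃ (v : Module.Basis (Fin n) ℚ (NQ N)) (u : Fin n → N),
      (∀ i, v i = (1 : ℚ) ⊗ₜ[ℤ] u i) ∧ σ = faceCone v Finset.univ := by
  obtain ⟨s, hs, hli, rfl⟩ := hsimp
  have := hs.fintype
  have hli' : LinearIndependent ℚ ((↑) : s → NQ N) := hli
  have hspan : linSpan (PointedCone.hull ℚ s) = Submodule.span ℚ s := by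
    apply le_antisymm
    · exact Submodule.span_le.2 (PointedCone.hull_le_span ℚ s)
    · exact Submodule.span_mono PointedCone.subset_hull
  have hcard : Fintype.card s = n := by
    rw [← hdim, dim, hspan, ← finrank_span_eq_card (R := ℚ) hli',
      Subtype.range_coe]
  have hrank : Module.finrank ℚ (NQ N) = n := by rw [Module.finrank_baseChange, hn]
  have htop : Submodule.span ℚ s = ⊤ := by
    apply Submodule.eq_top_of_finrank_eq
    rw [hrank, ← hspan]
    exact hdim
  let b : Module.Basis (Fin n) ℚ (NQ N) :=
    (Module.Basis.mk (v := ((↑) : s → NQ N)) hli' (by rw [Subtype.range_coe, htop])).reindex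
      (Fintype.equivFinOfCardEq hcard)
  have hb : ∀ i, b i ∈ s := fun i => by simp [b]
  have hb' : ∀ x ∈ s, ∃ i, b i = x := fun x hx =>
    ⟨Fintype.equivFinOfCardEq hcard ⟨x, hx⟩, by simp [b]⟩
  choose d hd u hu using fun i => exists_pos_smul_eq_tmul (b i)
  refine ⟨b.isUnitSMul fun i => (hd i).ne'.isUnit, u, fun i => ?_, ?_⟩
  · rw [Module.Basis.isUnitSMul_apply, hu]
  · apply le_antisymm
    · refine Submodule.span_le.2 fun x hx => ?_
      obtain ⟨i, rfl⟩ := hb' x hx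
      have h1 : b i = (d i)⁻¹ • (b.isUnitSMul fun i => (hd i).ne'.isUnit) i := by
        rw [Module.Basis.isUnitSMul_apply, smul_smul, inv_mul_cancel₀ (hd i).ne', one_smul]
      rw [h1]
      exact PointedCone.smul_mem _ (inv_nonneg.2 (hd i).le)
        ((basis_mem_faceCone _).2 (Finset.mem_univ i))
    · intro x hx
      rw [eq_sum_of_off_eq_zero _ fun j hj => (hx j).2 hj]
      refine Submodule.sum_mem _ fun i _ => PointedCone.smul_mem _ (hx i).1 ?_
      rw [Module.Basis.isUnitSMul_apply]
      exact PointedCone.smul_mem _ (hd i).le (PointedCone.subset_hull (hb i))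

omit [Module.Free ℤ N] [Module.Finite ℤ N] in
lemma faceCone_reindex (v : Module.Basis (Fin n) ℚ (NQ N)) (e : Fin n ≃ Fin n)
    (S : Finset (Fin n)) : faceCone (v.reindex e) (S.map e.toEmbedding) = faceCone v S := by
  ext x
  rw [mem_faceCone, mem_faceCone]
  constructor
  · intro h i
    simpa using h (e i)
  · intro h i
    obtain ⟨j, rfl⟩ := e.surjective i
    simpa using h j

/-- A basis adapted to a full-dimensional simplicial cone, numbered compatibly with a numbering of
the facets. -/
lemma exists_adapted_basis (hn : Module.finrank ℤ N = n) {σ : Cone N} (hdim : dim σ = n)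
    (hsimp : σ.IsSimplicial) {τ : Fin n → Cone N} (hτ_inj : Function.Injective τ)
    (hτ : ∀ i, IsFacet (τ i) σ) :
    ∃ (v : Module.Basis (Fin n) ℚ (NQ N)) (u : Fin n → N),
      (∀ i, v i = (1 : ℚ) ⊗ₜ[ℤ] u i) ∧ σ = faceCone v Finset.univ ∧
        ∀ i, τ i = faceCone v (Finset.univ.erase i) := by
  obtain ⟨v, u, hu, rfl⟩ := exists_basis_of_isSimplicial hn hdim hsimp
  choose e _ he using fun i => (isFacet_faceCone_iff v).1 (hτ i)
  have hinj : Function.Injective e := fun i j h => hτ_inj (by rw [he, he, h])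
  let e' : Fin n ≃ Fin n := Equiv.ofBijective e (Finite.injective_iff_bijective.1 hinj)
  refine ⟨v.reindex e'.symm, u ∘ e, fun i => by simp [hu, e'], ?_, fun i => ?_⟩
  · rw [← faceCone_reindex v e'.symm, Finset.map_univ_equiv]
  · rw [he, ← faceCone_reindex v e'.symm, Finset.map_erase, Finset.map_univ_equiv]
    congr 2
    exact e'.symm_apply_apply i

end Adapted

/-! ### First lattice points and their coordinates. -/

section Lattice

variable {N : Type*} [AddCommGroup N] {ι : Type*} [Fintype ι]
  (v : Module.Basis ι ℚ (NQ N))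

/-- A coordinate function of a basis of `N_ℚ`, restricted to the lattice. -/
noncomputable def latticeCoord (l : ι) : N →ₗ[ℤ] ℚ := onLattice N (v.coord l)

lemma tmul_eq_sum_latticeCoord {S : Finset ι} {y : N} (h : ∀ l ∉ S, latticeCoord v l y = 0) :
    (1 : ℚ) ⊗ₜ[ℤ] y = ∑ i ∈ S, latticeCoord v i y • v i :=
  eq_sum_of_off_eq_zero v h

omit [Fintype ι] in
lemma latticeCoord_generator [DecidableEq ι] {u : ι → N} (hu : ∀ i, v i = (1 : ℚ) ⊗ₜ[ℤ] u i)
    (l i : ι) : latticeCoord v l (u i) = if i = l then 1 else 0 := by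
  change v.coord l ((1 : ℚ) ⊗ₜ[ℤ] u i) = _
  rw [← hu, Module.Basis.coord_apply, v.repr_self, Finsupp.single_apply]

lemma latticeCoord_of_mem_latticeSpan {S : Finset ι} {y : N}
    (hy : y ∈ latticeSpan (faceCone v S)) {l : ι} (hl : l ∉ S) : latticeCoord v l y = 0 := by
  classical
  have h : v.coord l ∈ perp (faceCone v S) := (mem_perp_faceCone v).2 fun i hi => by
    rw [Module.Basis.coord_apply, v.repr_self, Finsupp.single_apply, if_neg]
    rintro rfl
    exact hl hi
  exact perp_onLattice h hy

/-- The lattice `N_S` is saturated: a lattice point in the span of the face enters the cone after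
adding a large multiple of the interior point `∑ u i`. -/
lemma mem_latticeSpan_faceCone {u : ι → N} (hu : ∀ i, v i = (1 : ℚ) ⊗ₜ[ℤ] u i)
    {S : Finset ι} {y : N} :
    y ∈ latticeSpan (faceCone v S) ↔ ∀ l ∉ S, latticeCoord v l y = 0 := by
  classical
  refine ⟨fun hy l hl => latticeCoord_of_mem_latticeSpan v hy hl, fun h => ?_⟩
  obtain ⟨K, hK⟩ := exists_nat_ge (∑ i, |latticeCoord v i y|)
  have hK' : ∀ i, |latticeCoord v i y| ≤ K := fun i =>
    (Finset.single_le_sum (f := fun i => |latticeCoord v i y|)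
      (fun _ _ => abs_nonneg _) (Finset.mem_univ i)).trans hK
  have hs : ∀ l, latticeCoord v l (∑ i ∈ S, u i) = if l ∈ S then 1 else 0 := fun l => by
    simp_rw [map_sum, latticeCoord_generator v hu, Finset.sum_ite_eq']
  have h1 : ∑ i ∈ S, u i ∈ latticeSpan (faceCone v S) := by
    refine Submodule.sum_mem _ fun i hi => Submodule.subset_span ?_
    change (1 : ℚ) ⊗ₜ[ℤ] u i ∈ faceCone v S
    rw [← hu]
    exact (basis_mem_faceCone v).2 hi
  have h2 : y + K • ∑ i ∈ S, u i ∈ latticeSpan (faceCone v S) := by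
    refine Submodule.subset_span fun l => ?_
    change 0 ≤ latticeCoord v l _ ∧ (l ∉ S → latticeCoord v l _ = 0)
    rw [map_add, map_nsmul, hs]
    constructor
    · split_ifs with hl
      · have := neg_abs_le (latticeCoord v l y)
        have := hK' l
        simp only [nsmul_eq_mul, mul_one]
        linarith
      · simp [h l hl]
    · intro hl
      simp [hl, h l hl]
  have h3 := Submodule.sub_mem _ h2 ((latticeSpan (faceCone v S)).nsmul_mem h1 K)
  rwa [add_sub_cancel_right] at h3

variable [DecidableEq ι]

/-- Modulo the facet the cone becomes the ray of `v j`, so position on it is read off from the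
`j`-th coordinate. -/
lemma tmul_mem_imageCone {u : ι → N} (hu : ∀ i, v i = (1 : ℚ) ⊗ₜ[ℤ] u i)
    {J : Finset ι} {j : ι} (hj : j ∈ J) {z : N} :
    (1 : ℚ) ⊗ₜ[ℤ] (latticeSpan (faceCone v (J.erase j))).mkQ z ∈
        imageCone (faceCone v (J.erase j)) (faceCone v J) ↔
      z ∈ latticeSpan (faceCone v J) ∧ 0 ≤ latticeCoord v j z := by
  set Q := (latticeSpan (faceCone v (J.erase j))).mkQ with hQ
  rw [imageCone, PointedCone.mem_map]
  constructor
  · rintro ⟨x, hx, hxz⟩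
    have key : ∀ l ∉ J.erase j, v.repr x l = latticeCoord v l z := by
      intro l hl
      -- Coordinates outside the facet vanish on its lattice, so they descend to the quotient and
      -- can be recovered there after base change.
      let g : (N ⧸ latticeSpan (faceCone v (J.erase j))) →ₗ[ℤ] ℚ :=
        Submodule.liftQ _ (latticeCoord v l)
          fun y hy => latticeCoord_of_mem_latticeSpan v hy hl
      have hg : ∀ x : NQ N, g.liftBaseChange ℚ (Q.baseChange ℚ x) = v.coord l x := by
        intro x
        induction x using TensorProduct.induction_on with
        | zero => simp
        | add x y hx hy => rw [map_add, map_add, map_add, hx, hy]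
        | tmul q y =>
          rw [LinearMap.baseChange_tmul, LinearMap.liftBaseChange_tmul]
          have : q ⊗ₜ[ℤ] y = q • ((1 : ℚ) ⊗ₜ[ℤ] y) := by
            rw [TensorProduct.smul_tmul', smul_eq_mul, mul_one]
          rw [this, map_smul]
          rfl
      have h1 := hg x
      rw [hxz, LinearMap.liftBaseChange_tmul, one_smul] at h1
      exact h1.symm
    refine ⟨(mem_latticeSpan_faceCone v hu).2 fun l hl => ?_, ?_⟩
    · rw [← key l fun h => hl (Finset.mem_of_mem_erase h)]
      exact (hx l).2 hl
    · rw [← key j (Finset.notMem_erase j J)]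
      exact (hx j).1
  · rintro ⟨hz, h0⟩
    refine ⟨latticeCoord v j z • v j,
      PointedCone.smul_mem _ h0 ((basis_mem_faceCone v).2 hj), ?_⟩
    have h1 : (1 : ℚ) ⊗ₜ[ℤ] Q z = Q.baseChange ℚ ((1 : ℚ) ⊗ₜ[ℤ] z) := by
      rw [LinearMap.baseChange_tmul]
    rw [h1, tmul_eq_sum_latticeCoord v ((mem_latticeSpan_faceCone v hu).1 hz),
      ← Finset.add_sum_erase _ _ hj, map_add, map_sum, left_eq_add]
    refine Finset.sum_eq_zero fun i hi => ?_
    rw [map_smul, hu, LinearMap.baseChange_tmul]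
    have : Q (u i) = 0 := by
      rw [hQ, Submodule.mkQ_apply, Submodule.Quotient.mk_eq_zero, mem_latticeSpan_faceCone v hu]
      intro l hl
      rw [latticeCoord_generator v hu, if_neg]
      rintro rfl
      exact hl hi
    rw [this, TensorProduct.tmul_zero, smul_zero]

lemma mem_latticeSpan_erase {u : ι → N} (hu : ∀ i, v i = (1 : ℚ) ⊗ₜ[ℤ] u i)
    {J : Finset ι} {j : ι} {z : N} (hz : z ∈ latticeSpan (faceCone v J))
    (h : latticeCoord v j z = 0) : z ∈ latticeSpan (faceCone v (J.erase j)) := by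
  rw [mem_latticeSpan_faceCone v hu] at hz ⊢
  intro l hl
  by_cases hlj : l = j
  · rw [hlj, h]
  · exact hz l fun hlJ => hl (Finset.mem_erase.2 ⟨hlj, hlJ⟩)

/-- The values of the `j`-th coordinate form a finitely generated subgroup of `ℚ`, a fractional
ideal of `ℤ`, hence principal; the sign of the generator can be chosen. -/
lemma exists_latticeCoord_generator [Module.Finite ℤ N] {u : ι → N}
    (hu : ∀ i, v i = (1 : ℚ) ⊗ₜ[ℤ] u i) {J : Finset ι} {j : ι} (hj : j ∈ J) :
    ∃ x ∈ latticeSpan (faceCone v J), 0 < latticeCoord v j x ∧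
      ∀ y ∈ latticeSpan (faceCone v J), ∃ k : ℤ, latticeCoord v j y = k * latticeCoord v j x := by
  set R := (latticeSpan (faceCone v J)).map (latticeCoord v j) with hR
  have hfg : R.FG := (IsNoetherian.noetherian (latticeSpan (faceCone v J))).map _
  have hfr := FractionalIdeal.isFractional_of_fg (S := nonZeroDivisors ℤ) hfg
  obtain ⟨g, hg⟩ := FractionalIdeal.isPrincipal (⟨R, hfr⟩ : FractionalIdeal (nonZeroDivisors ℤ) ℚ)
  change R = _ at hg
  have h1 : ∀ y ∈ latticeSpan (faceCone v J), ∃ k : ℤ, latticeCoord v j y = k * g := by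
    intro y hy
    have : latticeCoord v j y ∈ R := Submodule.mem_map_of_mem hy
    rw [hg] at this
    obtain ⟨k, hk⟩ := Submodule.mem_span_singleton.1 this
    exact ⟨k, by rw [← hk, zsmul_eq_mul]⟩
  obtain ⟨x, hx, hxg⟩ : g ∈ R := hg ▸ Submodule.mem_span_singleton_self g
  have hg0 : g ≠ 0 := by
    rintro rfl
    have huj : u j ∈ latticeSpan (faceCone v J) := by
      rw [mem_latticeSpan_faceCone v hu]
      intro l hl
      rw [latticeCoord_generator v hu, if_neg]
      rintro rfl
      exact hl hj
    obtain ⟨k, hk⟩ := h1 _ huj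
    rw [latticeCoord_generator v hu] at hk
    simp at hk
  rcases hg0.lt_or_gt with h | h
  · refine ⟨-x, Submodule.neg_mem _ hx, by rw [map_neg, hxg]; linarith, fun y hy => ?_⟩
    obtain ⟨k, hk⟩ := h1 y hy
    exact ⟨-k, by rw [hk, map_neg, hxg]; push_cast; ring⟩
  · refine ⟨x, hx, by rwa [hxg], fun y hy => ?_⟩
    rw [hxg]
    exact h1 y hy

lemma exists_isFirstLatticePoint [Module.Finite ℤ N] {u : ι → N}
    (hu : ∀ i, v i = (1 : ℚ) ⊗ₜ[ℤ] u i) {J : Finset ι} {j : ι} (hj : j ∈ J) :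
    ∃ x, IsFirstLatticePoint (faceCone v (J.erase j)) (faceCone v J) x := by
  obtain ⟨x, hx, hpos, hgen⟩ := exists_latticeCoord_generator v hu hj
  refine ⟨⟨_, Submodule.mem_map_of_mem hx⟩, (tmul_mem_imageCone v hu hj).2 ⟨hx, hpos.le⟩,
    fun h => ?_, fun y hy => ?_⟩
  · have h' : (latticeSpan (faceCone v (J.erase j))).mkQ x = 0 := congrArg Subtype.val h
    rw [Submodule.mkQ_apply, Submodule.Quotient.mk_eq_zero] at h'
    exact hpos.ne' (latticeCoord_of_mem_latticeSpan v h' (Finset.notMem_erase j J))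
  · obtain ⟨z, rfl⟩ := Submodule.mkQ_surjective _ y
    obtain ⟨hz, h0⟩ := (tmul_mem_imageCone v hu hj).1 hy
    obtain ⟨k, hk⟩ := hgen z hz
    have hk0 : 0 ≤ k := by
      by_contra hneg
      have : (k : ℚ) < 0 := by exact_mod_cast not_le.1 hneg
      nlinarith
    refine ⟨k.toNat, ?_⟩
    have hmem := mem_latticeSpan_erase v hu
      (Submodule.sub_mem _ hz ((latticeSpan (faceCone v J)).nsmul_mem hx k.toNat))
      (j := j) (by
        rw [map_sub, map_nsmul, hk, nsmul_eq_mul]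
        have : ((k.toNat : ℤ) : ℚ) = k := by rw [Int.toNat_of_nonneg hk0]
        rw [← this, Int.cast_natCast, sub_self])
    rw [← sub_eq_zero, ← map_nsmul, ← map_sub, Submodule.mkQ_apply,
      Submodule.Quotient.mk_eq_zero]
    exact hmem

/-- `n_{τ,σ}` has a representative in `N_τ` which generates `N_τ / N_σ` and has a positive
coordinate. -/
lemma exists_lift_firstLatticePoint [Module.Finite ℤ N] {u : ι → N}
    (hu : ∀ i, v i = (1 : ℚ) ⊗ₜ[ℤ] u i) {J : Finset ι} {j : ι} (hj : j ∈ J) :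
    ∃ x ∈ latticeSpan (faceCone v J),
      (latticeSpan (faceCone v (J.erase j))).mkQ x =
        firstLatticePoint (faceCone v (J.erase j)) (faceCone v J) ∧
      0 < latticeCoord v j x ∧
      ∀ y ∈ latticeSpan (faceCone v J), ∃ k : ℤ, latticeCoord v j y = k * latticeCoord v j x := by
  have hex := exists_isFirstLatticePoint v hu hj
  have hfirst : IsFirstLatticePoint (faceCone v (J.erase j)) (faceCone v J)
      (firstLatticePoint (faceCone v (J.erase j)) (faceCone v J)) := by
    rw [firstLatticePoint, dif_pos hex]
    exact hex.choose_spec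
  obtain ⟨h1, h2, h3⟩ := hfirst
  obtain ⟨x, hx, hxe⟩ := (firstLatticePoint (faceCone v (J.erase j)) (faceCone v J)).2
  rw [← hxe] at h1 h3
  have h0 := ((tmul_mem_imageCone v hu hj).1 h1).2
  have hne : latticeCoord v j x ≠ 0 := by
    intro h
    refine h2 (Subtype.ext ?_)
    rw [← hxe, Submodule.mkQ_apply, Submodule.coe_zero, Submodule.Quotient.mk_eq_zero]
    exact mem_latticeSpan_erase v hu hx h
  have key : ∀ y ∈ latticeSpan (faceCone v J), 0 ≤ latticeCoord v j y →
      ∃ k : ℕ, latticeCoord v j y = k * latticeCoord v j x := by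
    intro y hy hy0
    obtain ⟨k, hk⟩ := h3 _ ((tmul_mem_imageCone v hu hj).2 ⟨hy, hy0⟩)
    rw [← sub_eq_zero, ← map_nsmul, ← map_sub, Submodule.mkQ_apply,
      Submodule.Quotient.mk_eq_zero] at hk
    have := latticeCoord_of_mem_latticeSpan v hk (Finset.notMem_erase j J)
    rw [map_sub, map_nsmul, sub_eq_zero, nsmul_eq_mul] at this
    exact ⟨k, this⟩
  refine ⟨x, hx, hxe, lt_of_le_of_ne h0 hne.symm, fun y hy => ?_⟩
  rcases le_total 0 (latticeCoord v j y) with h | h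
  · obtain ⟨k, hk⟩ := key y hy h
    exact ⟨k, by exact_mod_cast hk⟩
  · obtain ⟨k, hk⟩ := key (-y) (Submodule.neg_mem _ hy) (by rw [map_neg]; linarith)
    rw [map_neg] at hk
    exact ⟨-k, by push_cast; linarith⟩

/-- A system of representatives `X J j` of the lattice points `n_{τ,σ}`, where `τ` and `σ` are the
faces spanned by `J` and by `J \ {j}`. -/
structure IsLatticeSystem (X : Finset ι → ι → N) : Prop where
  mem : ∀ {J j}, j ∈ J → X J j ∈ latticeSpan (faceCone v J)
  mkQ_eq : ∀ {J j}, j ∈ J → (latticeSpan (faceCone v (J.erase j))).mkQ (X J j) =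
    firstLatticePoint (faceCone v (J.erase j)) (faceCone v J)
  pos : ∀ {J j}, j ∈ J → 0 < latticeCoord v j (X J j)
  gen : ∀ {J j}, j ∈ J → ∀ y ∈ latticeSpan (faceCone v J),
    ∃ k : ℤ, latticeCoord v j y = k * latticeCoord v j (X J j)

lemma exists_isLatticeSystem [Module.Finite ℤ N] {u : ι → N}
    (hu : ∀ i, v i = (1 : ℚ) ⊗ₜ[ℤ] u i) : ∃ X : Finset ι → ι → N, IsLatticeSystem v X := by
  have h : ∀ (J : Finset ι) (j : ι), ∃ x : N, j ∈ J → x ∈ latticeSpan (faceCone v J) ∧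
      (latticeSpan (faceCone v (J.erase j))).mkQ x =
        firstLatticePoint (faceCone v (J.erase j)) (faceCone v J) ∧
      0 < latticeCoord v j x ∧
      ∀ y ∈ latticeSpan (faceCone v J),
        ∃ k : ℤ, latticeCoord v j y = k * latticeCoord v j x := by
    intro J j
    by_cases hj : j ∈ J
    · obtain ⟨x, h1, h2⟩ := exists_lift_firstLatticePoint v hu hj
      exact ⟨x, fun _ => ⟨h1, h2⟩⟩
    · exact ⟨0, fun h => absurd h hj⟩
  choose X hX using h
  exact ⟨X, fun hj => (hX _ _ hj).1, fun hj => (hX _ _ hj).2.1, fun hj => (hX _ _ hj).2.2.1,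
    fun hj => (hX _ _ hj).2.2.2⟩

variable {v}

lemma IsLatticeSystem.exists_sub_zsmul_mem {X : Finset ι → ι → N} (hX : IsLatticeSystem v X)
    {u : ι → N} (hu : ∀ i, v i = (1 : ℚ) ⊗ₜ[ℤ] u i) {J : Finset ι} {j : ι} (hj : j ∈ J) {y : N}
    (hy : y ∈ latticeSpan (faceCone v J)) :
    ∃ k : ℤ, latticeCoord v j y = k * latticeCoord v j (X J j) ∧
      y - k • X J j ∈ latticeSpan (faceCone v (J.erase j)) := by
  obtain ⟨k, hk⟩ := hX.gen hj y hy
  refine ⟨k, hk, mem_latticeSpan_erase v hu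
    (Submodule.sub_mem _ hy (Submodule.smul_mem _ k (hX.mem hj))) ?_⟩
  rw [map_sub, map_zsmul, hk, zsmul_eq_mul, sub_self]

/-- Modulo the face `J \ {a, b}`, the vectors `X J a` and `X (J.erase a) b` form a basis of a
rank-two lattice, triangular in the coordinates `a`, `b`. Expressing the pair for the opposite order
in this basis multiplies the determinant by an integer. -/
lemma IsLatticeSystem.exists_int_mul {X : Finset ι → ι → N} (hX : IsLatticeSystem v X)
    {u : ι → N} (hu : ∀ i, v i = (1 : ℚ) ⊗ₜ[ℤ] u i) {J : Finset ι} {a b : ι} (ha : a ∈ J)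
    (hb : b ∈ J) (hab : a ≠ b) :
    ∃ k : ℤ, latticeCoord v b (X J b) * latticeCoord v a (X (J.erase b) a) =
      k * (latticeCoord v a (X J a) * latticeCoord v b (X (J.erase a) b)) := by
  have hbJ : b ∈ J.erase a := Finset.mem_erase.2 ⟨hab.symm, hb⟩
  have haJ : a ∈ J.erase b := Finset.mem_erase.2 ⟨hab, ha⟩
  have decomp : ∀ y ∈ latticeSpan (faceCone v J), ∃ k k' : ℤ,
      latticeCoord v a y = k * latticeCoord v a (X J a) ∧
      latticeCoord v b y =
        k * latticeCoord v b (X J a) + k' * latticeCoord v b (X (J.erase a) b) := by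
    intro y hy
    obtain ⟨k, hk, hmem⟩ := hX.exists_sub_zsmul_mem hu ha hy
    obtain ⟨k', hk'⟩ := hX.gen hbJ _ hmem
    refine ⟨k, k', hk, ?_⟩
    rw [map_sub, map_zsmul, zsmul_eq_mul] at hk'
    linarith
  obtain ⟨k₁, l₁, h₁, h₁'⟩ := decomp (X J b) (hX.mem hb)
  have hmem : X (J.erase b) a ∈ latticeSpan (faceCone v J) := by
    rw [mem_latticeSpan_faceCone v hu]
    exact fun l hl => latticeCoord_of_mem_latticeSpan v (hX.mem haJ)
      fun h => hl (Finset.mem_of_mem_erase h)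
  obtain ⟨k₂, l₂, h₂, h₂'⟩ := decomp _ hmem
  rw [latticeCoord_of_mem_latticeSpan v (hX.mem haJ) (Finset.notMem_erase b J)] at h₂'
  refine ⟨l₁ * k₂ - k₁ * l₂, ?_⟩
  rw [h₁', h₂]
  push_cast
  linear_combination (-k₁ * latticeCoord v a (X J a)) * h₂'

/-- Both products are positive and each is an integer multiple of the other; they are the covolume
of the same rank-two lattice. -/
lemma IsLatticeSystem.mul_comm {X : Finset ι → ι → N} (hX : IsLatticeSystem v X)
    {u : ι → N} (hu : ∀ i, v i = (1 : ℚ) ⊗ₜ[ℤ] u i) {J : Finset ι} {a b : ι} (ha : a ∈ J)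
    (hb : b ∈ J) (hab : a ≠ b) :
    latticeCoord v a (X J a) * latticeCoord v b (X (J.erase a) b) =
      latticeCoord v b (X J b) * latticeCoord v a (X (J.erase b) a) := by
  have hpos : ∀ {a b : ι}, a ∈ J → b ∈ J → a ≠ b →
      0 < latticeCoord v a (X J a) * latticeCoord v b (X (J.erase a) b) := fun ha hb hab =>
    mul_pos (hX.pos ha) (hX.pos (Finset.mem_erase.2 ⟨hab.symm, hb⟩))
  have hle : ∀ {P Q : ℚ}, 0 < P → 0 < Q → (∃ k : ℤ, P = k * Q) → Q ≤ P := by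
    rintro P Q hP hQ ⟨k, rfl⟩
    have hk : (0 : ℚ) < k := pos_of_mul_pos_left hP hQ.le
    have hk1 : (1 : ℚ) ≤ k := by exact_mod_cast (Int.cast_pos.1 hk : 0 < k)
    nlinarith
  have h1 := hpos ha hb hab
  have h2 := hpos hb ha hab.symm
  exact le_antisymm (hle h2 h1 (hX.exists_int_mul hu ha hb hab))
    (hle h1 h2 (hX.exists_int_mul hu hb ha hab.symm))

end Lattice

/-! ### Commuting operators on functions on faces. -/

section FaceAction

variable {ι M : Type*} [DecidableEq ι] [AddCommGroup M] [Module ℚ M]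

/-- The operator on functions on the faces of a simplex obtained by summing over facets, weighted by
`c` and by the linear functionals `ℓ`. -/
def faceAct (c : Finset ι → ι → ℚ) (ℓ : Finset ι → ι → M →ₗ[ℚ] ℚ) (m : M) (f : Finset ι → ℚ) :
    Finset ι → ℚ :=
  fun J => ∑ j ∈ J, c J j * ℓ (J.erase j) j m * f (J.erase j)

/-- Each face `J \ {a, b}` is reached by two chains. By `hc` they carry equal weights, and by `hℓ`
the sum of their functional factors is symmetric in `m` and `m'`. -/
lemma faceAct_comm {c : Finset ι → ι → ℚ} {ℓ : Finset ι → ι → M →ₗ[ℚ] ℚ}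
    (hc : ∀ (J : Finset ι) (a b : ι), a ∈ J → b ∈ J → a ≠ b →
      c J a * c (J.erase a) b = c J b * c (J.erase b) a)
    (hℓ : ∀ (J : Finset ι) (a b : ι), a ∈ J → b ∈ J → a ≠ b → ∀ m m' : M,
      ℓ (J.erase a) a m * ℓ ((J.erase a).erase b) b m' +
          ℓ (J.erase b) b m * ℓ ((J.erase a).erase b) a m' =
        ℓ (J.erase a) a m' * ℓ ((J.erase a).erase b) b m +
          ℓ (J.erase b) b m' * ℓ ((J.erase a).erase b) a m)
    (m m' : M) (f : Finset ι → ℚ) :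
    faceAct c ℓ m (faceAct c ℓ m' f) = faceAct c ℓ m' (faceAct c ℓ m f) := by
  have expand : ∀ (m m' : M) (J : Finset ι), faceAct c ℓ m (faceAct c ℓ m' f) J =
      ∑ a ∈ J, ∑ b ∈ J.erase a, c J a * c (J.erase a) b * f ((J.erase a).erase b) *
        (ℓ (J.erase a) a m * ℓ ((J.erase a).erase b) b m') := by
    intro m m' J
    simp only [faceAct, Finset.mul_sum]
    exact Finset.sum_congr rfl fun a _ => Finset.sum_congr rfl fun b _ => by ring
  have swap : ∀ (m m' : M) (J : Finset ι), faceAct c ℓ m (faceAct c ℓ m' f) J =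
      ∑ a ∈ J, ∑ b ∈ J.erase a, c J a * c (J.erase a) b * f ((J.erase a).erase b) *
        (ℓ (J.erase b) b m * ℓ ((J.erase a).erase b) a m') := by
    intro m m' J
    rw [expand]
    rw [Finset.sum_comm' (t' := J) (s' := fun b => J.erase b)
      (by intro x y; simp only [Finset.mem_erase]; tauto)]
    refine Finset.sum_congr rfl fun a ha => Finset.sum_congr rfl fun b hb => ?_
    rw [Finset.mem_erase] at hb
    rw [Finset.erase_right_comm (a := b) (b := a), hc J b a hb.2 ha hb.1]
  funext J
  -- Only the sum over both orders of `a` and `b` is symmetric, so the identity is proved doubled,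
  -- adding the sum to its reindexed copy.
  have h2 : faceAct c ℓ m (faceAct c ℓ m' f) J + faceAct c ℓ m (faceAct c ℓ m' f) J =
      faceAct c ℓ m' (faceAct c ℓ m f) J + faceAct c ℓ m' (faceAct c ℓ m f) J := by
    nth_rw 1 [expand]
    nth_rw 1 [swap]
    nth_rw 1 [expand]
    nth_rw 1 [swap]
    rw [← Finset.sum_add_distrib, ← Finset.sum_add_distrib]
    refine Finset.sum_congr rfl fun a ha => ?_
    rw [← Finset.sum_add_distrib, ← Finset.sum_add_distrib]
    refine Finset.sum_congr rfl fun b hb => ?_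
    rw [Finset.mem_erase] at hb
    rw [← mul_add, ← mul_add, hℓ J a b ha hb.2 hb.1.symm m m']
  linarith

lemma foldr_faceAct_comm {c : Finset ι → ι → ℚ} {ℓ : Finset ι → ι → M →ₗ[ℚ] ℚ}
    (hcomm : ∀ m m' f, faceAct c ℓ m (faceAct c ℓ m' f) = faceAct c ℓ m' (faceAct c ℓ m f))
    (e : M) (l : List M) (f : Finset ι → ℚ) :
    faceAct c ℓ e (l.foldr (faceAct c ℓ) f) = l.foldr (faceAct c ℓ) (faceAct c ℓ e f) := by
  induction l with
  | nil => rfl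
  | cons m l ih => rw [List.foldr_cons, List.foldr_cons, hcomm, ih]

/-- If the action on the top face is a multiple of a functional `w`, then products of commuting
actions are a multiple of a product of values of `w`, by a factor depending only on the number of
actions. -/
lemma foldr_faceAct_top {c : Finset ι → ι → ℚ} {ℓ : Finset ι → ι → M →ₗ[ℚ] ℚ}
    (hcomm : ∀ m m' f, faceAct c ℓ m (faceAct c ℓ m' f) = faceAct c ℓ m' (faceAct c ℓ m f))
    {T : Finset ι} {w : M → ℚ} {e : M}
    (htop : ∀ m f, faceAct c ℓ m f T = w m * faceAct c ℓ e f T) (l : List M)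
    (f : Finset ι → ℚ) :
    l.foldr (faceAct c ℓ) f T = (l.map w).prod * ((faceAct c ℓ e)^[l.length] f) T := by
  induction l generalizing f with
  | nil => simp
  | cons m l ih =>
    -- The outermost factor is traded for `e`, which then commutes inward to the initial function,
    -- exposing the next factor.
    rw [List.foldr_cons, htop, foldr_faceAct_comm hcomm, ih, List.map_cons, List.prod_cons,
      List.length_cons, Function.iterate_succ_apply, mul_assoc]

end FaceAction

/-! ### Projections along the steps of a generic flag. -/

lemma CompleteFlag.exists_generator {K W : Type*} [Field K] [AddCommGroup W] [Module K W]
    [FiniteDimensional K W] (L : CompleteFlag K W) {k : ℕ} (hk : k < Module.finrank K W) :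
    ∃ g ∈ L.F (k + 1), g ∉ L.F k ∧ ∀ l ∈ L.F (k + 1), ∃ s : K, l - s • g ∈ L.F k := by
  obtain ⟨g, hg, hgk⟩ := SetLike.exists_of_lt (L.lt_succ k hk)
  refine ⟨g, hg, hgk, fun l hl => ?_⟩
  have hle : L.F k ⊔ Submodule.span K {g} ≤ L.F (k + 1) :=
    sup_le (L.lt_succ k hk).le ((Submodule.span_singleton_le_iff_mem _ _).2 hg)
  have hlt : L.F k < L.F k ⊔ Submodule.span K {g} :=
    lt_of_le_of_ne le_sup_left fun h =>
      hgk (h ▸ Submodule.mem_sup_right (Submodule.mem_span_singleton_self g))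
  have heq : L.F k ⊔ Submodule.span K {g} = L.F (k + 1) := by
    refine Submodule.eq_of_le_of_finrank_le hle ?_
    have := Submodule.finrank_lt_finrank_of_lt hlt
    rw [L.finrank_eq hk.le] at this
    rw [L.finrank_eq hk]
    exact this
  rw [← heq] at hl
  obtain ⟨y, hy, z, hz, rfl⟩ := Submodule.mem_sup.1 hl
  obtain ⟨s, rfl⟩ := Submodule.mem_span_singleton.1 hz
  exact ⟨s, by rwa [add_sub_cancel_right]⟩

section Projections

variable {N : Type*} [AddCommGroup N] [Module.Finite ℤ N] {ι : Type*} [Fintype ι]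
  {Δ : Fan N} {L : CompleteFlag ℚ (MQ N)} (hL : L.IsGeneric Δ)
  {v : Module.Basis ι ℚ (NQ N)} (hv : ∀ S, faceCone v S ∈ Δ.cones)

/-- The functional `m ↦ ⟨π_σ(m), v_j⟩`, where `σ` is the face spanned by `S`. -/
noncomputable def projCoord (S : Finset ι) (j : ι) : MQ N →ₗ[ℚ] ℚ :=
  (Module.Dual.eval ℚ (NQ N) (v j)) ∘ₗ (perp (faceCone v S)).subtype ∘ₗ
    (L.complements hL).proj ⟨faceCone v S, hv S⟩

omit [Fintype ι] in
lemma projCoord_apply (S : Finset ι) (j : ι) (m : MQ N) :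
    projCoord hL hv S j m =
      ((L.complements hL).proj ⟨faceCone v S, hv S⟩ m : MQ N) (v j) := rfl

omit [Fintype ι] in
lemma proj_mem_perp (S : Finset ι) (m : MQ N) :
    ((L.complements hL).proj ⟨faceCone v S, hv S⟩ m : MQ N) ∈ perp (faceCone v S) :=
  Subtype.prop _

lemma proj_eq_zero_iff (S : Finset ι) {m : MQ N} :
    (L.complements hL).proj ⟨faceCone v S, hv S⟩ m = 0 ↔ m ∈ L.F S.card := by
  rw [ComplementChoice.proj, Submodule.projectionOnto_apply_eq_zero_iff]
  change m ∈ L.F (dim (faceCone v S)) ↔ _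
  rw [dim_faceCone]

omit [Fintype ι] in
lemma proj_of_mem_perp {S : Finset ι} {m : MQ N} (hm : m ∈ perp (faceCone v S)) :
    ((L.complements hL).proj ⟨faceCone v S, hv S⟩ m : MQ N) = m :=
  congrArg Subtype.val (Submodule.projectionOnto_apply_left
    ((L.complements hL).isCompl ⟨faceCone v S, hv S⟩) ⟨m, hm⟩)

lemma sub_proj_mem (S : Finset ι) (m : MQ N) :
    m - ((L.complements hL).proj ⟨faceCone v S, hv S⟩ m : MQ N) ∈ L.F S.card := by
  rw [← proj_eq_zero_iff hL hv, map_sub, sub_eq_zero]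
  exact Subtype.ext (proj_of_mem_perp hL hv (proj_mem_perp hL hv S m)).symm

lemma projCoord_of_mem_flag {S : Finset ι} (j : ι) {m : MQ N} (hm : m ∈ L.F S.card) :
    projCoord hL hv S j m = 0 := by
  rw [projCoord_apply, (proj_eq_zero_iff hL hv S).2 hm]
  rfl

omit [Fintype ι] in
lemma projCoord_of_mem_perp {S : Finset ι} (j : ι) {m : MQ N}
    (hm : m ∈ perp (faceCone v S)) : projCoord hL hv S j m = m (v j) := by
  rw [projCoord_apply, proj_of_mem_perp hL hv hm]

variable [DecidableEq ι]

/-- This is where genericity enters: otherwise the projection of `m` would lie both in the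
annihilator of the enlarged face and in the matching flag step, so it would vanish, forcing `m` into
the smaller step. -/
lemma projCoord_ne_zero {S : Finset ι} {j : ι} (hj : j ∉ S) {m : MQ N}
    (hm : m ∈ L.F (S.card + 1)) (hm' : m ∉ L.F S.card) : projCoord hL hv S j m ≠ 0 := by
  intro h
  have hdim := dim_le (faceCone v (insert j S))
  rw [dim_faceCone, Finset.card_insert_of_notMem hj] at hdim
  set p : MQ N := ((L.complements hL).proj ⟨faceCone v S, hv S⟩ m : MQ N) with hp
  have h1 : p ∈ perp (faceCone v (insert j S)) := by
    rw [mem_perp_faceCone]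
    intro i hi
    rcases Finset.mem_insert.1 hi with rfl | hi
    · exact h
    · exact (mem_perp_faceCone v).1 (proj_mem_perp hL hv S m) i hi
  have h2 : p ∈ L.F (S.card + 1) := by
    have := Submodule.sub_mem _ hm
      (L.mono (Nat.le_succ _) hdim (sub_proj_mem hL hv S m))
    rwa [sub_sub_cancel] at this
  have h3 : p ∈ perp (faceCone v (insert j S)) ⊓ L.F (dim (faceCone v (insert j S))) := by
    rw [dim_faceCone, Finset.card_insert_of_notMem hj]
    exact ⟨h1, h2⟩
  rw [hL _ (hv _), Submodule.mem_bot] at h3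
  exact hm' ((proj_eq_zero_iff hL hv S).1 (Subtype.ext h3))

/-- The recursion for the functionals `projCoord`, in terms of a vector spanning the flag step. -/
lemma projCoord_insert {S : Finset ι} {g : MQ N} (hg : g ∈ L.F (S.card + 1))
    (hg' : g ∉ L.F S.card) (hgen : ∀ l ∈ L.F (S.card + 1), ∃ s : ℚ, l - s • g ∈ L.F S.card)
    {a : ι} (ha : a ∉ S) (b : ι) (m : MQ N) :
    projCoord hL hv (insert a S) b m = projCoord hL hv S b m -
      projCoord hL hv S b g / projCoord hL hv S a g * projCoord hL hv S a m := by
  have hp := projCoord_ne_zero hL hv ha hg hg'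
  set r : MQ N := ((L.complements hL).proj ⟨faceCone v (insert a S), hv (insert a S)⟩ m : MQ N)
    with hr
  have hrperp : r ∈ perp (faceCone v (insert a S)) := proj_mem_perp hL hv _ m
  have hrS : r ∈ perp (faceCone v S) :=
    perp_anti ((faceCone_le_iff v).2 (Finset.subset_insert a S)) hrperp
  have hl := sub_proj_mem hL hv (insert a S) m
  rw [Finset.card_insert_of_notMem ha, ← hr] at hl
  obtain ⟨s, hs⟩ := hgen _ hl
  -- The two projections of `m` differ by a multiple `s` of that of `g`; evaluating at `v a`, where
  -- `r` vanishes, determines `s`.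
  have h1 : ∀ x, projCoord hL hv S x m - r (v x) = s * projCoord hL hv S x g := by
    intro x
    have := projCoord_of_mem_flag hL hv x hs
    rwa [map_sub, map_sub, map_smul, smul_eq_mul, projCoord_of_mem_perp hL hv x hrS,
      sub_eq_zero] at this
  have h2 : r (v a) = 0 := (mem_perp_faceCone v).1 hrperp a (Finset.mem_insert_self a S)
  have h3 := h1 a
  rw [h2, sub_zero] at h3
  have h4 := h1 b
  rw [projCoord_apply, ← hr, h3]
  field_simp
  linarith

/-- Put `p = projCoord` on `I` and `q = p_a(g) / p_b(g)`. By the recursion the left side is `p_a(m)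
p_b(m') + p_b(m) p_a(m') - q p_b(m) p_b(m') - q⁻¹ p_a(m) p_a(m')`, visibly symmetric in `m` and
`m'`. -/
lemma projCoord_exchange {J : Finset ι} {a b : ι} (ha : a ∈ J) (hb : b ∈ J) (hab : a ≠ b)
    (m m' : MQ N) :
    projCoord hL hv (J.erase a) a m * projCoord hL hv ((J.erase a).erase b) b m' +
        projCoord hL hv (J.erase b) b m * projCoord hL hv ((J.erase a).erase b) a m' =
      projCoord hL hv (J.erase a) a m' * projCoord hL hv ((J.erase a).erase b) b m +
        projCoord hL hv (J.erase b) b m' * projCoord hL hv ((J.erase a).erase b) a m := by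
  set I := (J.erase a).erase b with hI
  have hbI : b ∉ I := Finset.notMem_erase _ _
  have haI : a ∉ I := fun h => Finset.notMem_erase a J (Finset.mem_of_mem_erase h)
  have hJa : J.erase a = insert b I :=
    (Finset.insert_erase (Finset.mem_erase.2 ⟨hab.symm, hb⟩)).symm
  have hJb : J.erase b = insert a I := by
    rw [hI, Finset.erase_right_comm, Finset.insert_erase (Finset.mem_erase.2 ⟨hab, ha⟩)]
  have hdim := dim_le (faceCone v (insert a I))
  rw [dim_faceCone, Finset.card_insert_of_notMem haI] at hdim
  obtain ⟨g, hg, hg', hgen⟩ := L.exists_generator (k := I.card) hdim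
  rw [hJa, hJb]
  simp only [projCoord_insert hL hv hg hg' hgen hbI a, projCoord_insert hL hv hg hg' hgen haI b]
  ring

/-- On the full-dimensional face the functionals are multiples of the pairing with a vector
perpendicular to the last proper step of the flag. -/
lemma exists_projCoord_univ {n : ℕ} (hn : Fintype.card ι = n) {w : NQ N} (hw : w ≠ 0)
    (hwL : ∀ l ∈ L.F (n - 1), l w = 0) :
    ∃ e : MQ N, ∀ (j : ι) (m : MQ N), projCoord hL hv (Finset.univ.erase j) j m =
      m w * projCoord hL hv (Finset.univ.erase j) j e := by
  have hrank : Module.finrank ℚ (MQ N) = n := by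
    rw [Subspace.dual_finrank_eq, Module.finrank_eq_card_basis v, hn]
  rcases Nat.eq_zero_or_pos n with rfl | hpos
  · refine absurd ?_ hw
    have : IsEmpty ι := Fintype.card_eq_zero_iff.1 hn
    exact v.repr.map_eq_zero_iff.1 (Subsingleton.elim _ _)
  obtain ⟨g, hg, hg', hgen⟩ := L.exists_generator (k := n - 1) (by omega)
  have htop : L.F (n - 1 + 1) = ⊤ := by rw [Nat.sub_add_cancel hpos, ← hrank, L.top]
  have hcoeff : ∀ m : MQ N, ∃ s : ℚ, m - s • g ∈ L.F (n - 1) ∧ m w = s * g w := by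
    intro m
    obtain ⟨s, hs⟩ := hgen m (htop ▸ Submodule.mem_top)
    refine ⟨s, hs, ?_⟩
    have := hwL _ hs
    rwa [LinearMap.sub_apply, LinearMap.smul_apply, smul_eq_mul, sub_eq_zero] at this
  have hgw : g w ≠ 0 := by
    intro h
    refine hw ((Module.forall_dual_apply_eq_zero_iff ℚ w).1 fun m => ?_)
    obtain ⟨s, _, hs⟩ := hcoeff m
    rw [hs, h, mul_zero]
  -- The functional `e` is normalised by `⟨e, w⟩ = 1`.
  refine ⟨(g w)⁻¹ • g, fun j m => ?_⟩
  obtain ⟨s, hs, hmw⟩ := hcoeff m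
  have hcard : (Finset.univ.erase j).card = n - 1 := by
    rw [Finset.card_erase_of_mem (Finset.mem_univ j), Finset.card_univ, hn]
  have h0 := projCoord_of_mem_flag hL hv (S := Finset.univ.erase j) j (hcard.symm ▸ hs)
  rw [map_sub, map_smul, smul_eq_mul, sub_eq_zero] at h0
  rw [h0, hmw, map_smul, smul_eq_mul]
  field_simp

end Projections

/-! ### The divisor action restricted to the faces of the cone. -/

section Coefficients

variable {N : Type*} [AddCommGroup N] {Δ : Fan N}

open Classical in
lemma ComplementChoice.actV_apply (P : ComplementChoice Δ) (D : QCartierDivisor Δ)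
    (σ τ : Δ.cones) :
    P.actV D σ τ =
      if h : IsFacet (σ : Cone N) (τ : Cone N) then P.coeff D σ τ h.isFace.le else 0 := by
  simp only [ComplementChoice.actV, Finsupp.finsetSum_apply, Finsupp.smul_apply, V, smul_eq_mul]
  split_ifs with h
  · rw [Finset.sum_eq_single (⟨τ, h⟩ : {τ : Δ.cones // IsFacet (σ : Cone N) (τ : Cone N)})]
    · simp
    · intro b _ hb
      rw [Finsupp.single_apply, if_neg fun h' => hb (Subtype.ext h'), mul_zero]
    · exact fun h' => absurd (@Finset.mem_univ _ (_) _) h'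
  · refine Finset.sum_eq_zero fun b _ => ?_
    rw [Finsupp.single_apply, if_neg fun h' : b.1 = τ => h (h' ▸ b.2), mul_zero]

variable {ι : Type*} [Fintype ι] [DecidableEq ι] {v : Module.Basis ι ℚ (NQ N)}
  (hv : ∀ S, faceCone v S ∈ Δ.cones)

lemma ComplementChoice.act_apply_face (P : ComplementChoice Δ) (D : QCartierDivisor Δ)
    (z : Cycles Δ) (J : Finset ι) :
    P.act D z ⟨faceCone v J, hv J⟩ =
      ∑ j ∈ J, P.coeff D ⟨faceCone v (J.erase j), hv _⟩ ⟨faceCone v J, hv J⟩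
        ((faceCone_le_iff v).2 (Finset.erase_subset j J)) *
          z ⟨faceCone v (J.erase j), hv _⟩ := by
  classical
  let e : ι → Δ.cones := fun j => ⟨faceCone v (J.erase j), hv _⟩
  have he : Set.InjOn e J := by
    intro i hi j hj hij
    have h1 : J.erase i = J.erase j := faceCone_injective v (congrArg Subtype.val hij)
    by_contra hne
    have : i ∈ J.erase j := Finset.mem_erase.2 ⟨hne, hi⟩
    rw [← h1] at this
    exact Finset.notMem_erase i J this
  let _ := Fintype.ofFinite Δ.cones
  rw [ComplementChoice.act, Finsupp.linearCombination_apply,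
    Finsupp.sum_fintype _ _ (by simp), Finsupp.finsetSum_apply,
    ← Finset.sum_subset (Finset.subset_univ (J.image e)), Finset.sum_image he]
  · refine Finset.sum_congr rfl fun j hj => ?_
    rw [Finsupp.smul_apply, smul_eq_mul, P.actV_apply,
      dif_pos ((isFacet_faceCone_iff v).2 ⟨j, hj, rfl⟩), mul_comm]
  · intro σ _ hσ
    rw [Finsupp.smul_apply, P.actV_apply, dif_neg, smul_zero]
    intro h
    obtain ⟨j, hj, h'⟩ := (isFacet_faceCone_iff v).1 h
    exact hσ (Finset.mem_image.2 ⟨j, hj, Subtype.ext h'.symm⟩)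

variable [Module.Finite ℤ N] {L : CompleteFlag ℚ (MQ N)} (hL : L.IsGeneric Δ)

/-- The projected equation kills every ray of the facet, so it sees only the `v j`-coordinate of a
lift of the first lattice point. -/
lemma coeff_face {X : Finset ι → ι → N} (hX : IsLatticeSystem v X) (D : QCartierDivisor Δ)
    {J : Finset ι} {j : ι} (hj : j ∈ J) {m : MQ N}
    (hm : D.localEq ⟨faceCone v J, hv J⟩ = Submodule.Quotient.mk m) :
    (L.complements hL).coeff D ⟨faceCone v (J.erase j), hv _⟩ ⟨faceCone v J, hv J⟩
        ((faceCone_le_iff v).2 (Finset.erase_subset j J)) =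
      latticeCoord v j (X J j) * projCoord hL hv (J.erase j) j m := by
  set p := (L.complements hL).proj ⟨faceCone v (J.erase j), hv _⟩ m with hp
  have h1 : (L.complements hL).coeff D ⟨faceCone v (J.erase j), hv _⟩ ⟨faceCone v J, hv J⟩
        ((faceCone_le_iff v).2 (Finset.erase_subset j J)) =
      pairing (faceCone v (J.erase j)) p
        (firstLatticePoint (faceCone v (J.erase j)) (faceCone v J)) := by
    rw [ComplementChoice.coeff, hm]
    rfl
  rw [h1, ← hX.mkQ_eq hj]
  change (p : MQ N) ((1 : ℚ) ⊗ₜ[ℤ] X J j) = _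
  rw [tmul_eq_sum_latticeCoord v fun l hl => latticeCoord_of_mem_latticeSpan v (hX.mem hj) hl,
    map_sum, ← Finset.add_sum_erase _ _ hj, Finset.sum_eq_zero, add_zero, map_smul, smul_eq_mul,
    projCoord_apply]
  intro i hi
  rw [map_smul, (mem_perp_faceCone v).1 p.2 i hi, smul_zero]

lemma act_apply_face_eq {X : Finset ι → ι → N} (hX : IsLatticeSystem v X)
    (D : QCartierDivisor Δ) {m : MQ N}
    (hm : D.localEq ⟨faceCone v Finset.univ, hv _⟩ = Submodule.Quotient.mk m) (z : Cycles Δ) :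
    (fun J => (L.complements hL).act D z ⟨faceCone v J, hv J⟩) =
      faceAct (fun J j => latticeCoord v j (X J j)) (projCoord hL hv) m
        (fun J => z ⟨faceCone v J, hv J⟩) := by
  funext J
  rw [ComplementChoice.act_apply_face hv]
  refine Finset.sum_congr rfl fun j hj => ?_
  -- Compatibility lets one representative on the top cone serve on all its faces.
  have hJ : D.localEq ⟨faceCone v J, hv J⟩ = Submodule.Quotient.mk m := by
    rw [← D.agree ⟨faceCone v J, hv J⟩ ⟨faceCone v Finset.univ, hv _⟩
      (isFaceOf_faceCone v (Finset.subset_univ J)), hm]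
    rfl
  rw [coeff_face hv hL hX D hj hJ]

lemma prod_apply_face {X : Finset ι → ι → N} (hX : IsLatticeSystem v X) {k : ℕ}
    (E : Fin k → QCartierDivisor Δ) (m : Fin k → MQ N)
    (hm : ∀ i, (E i).localEq ⟨faceCone v Finset.univ, hv _⟩ = Submodule.Quotient.mk (m i)) :
    (fun J => (L.complements hL).prod E ⟨faceCone v J, hv J⟩) =
      (List.ofFn m).foldr
        (faceAct (fun J j => latticeCoord v j (X J j)) (projCoord hL hv))
        (fun J => if J = ∅ then 1 else 0) := by
  unfold ComplementChoice.prod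
  induction k with
  | zero =>
    funext J
    simp only [List.ofFn_zero, List.foldr_nil, fundamentalCycle, V]
    rw [Finsupp.single_apply]
    refine if_congr ?_ rfl rfl
    rw [Subtype.mk.injEq, ← faceCone_empty v]
    exact ⟨fun h => (faceCone_injective v h).symm, fun h => by rw [h]⟩
  | succ k ih =>
    rw [List.ofFn_succ, List.ofFn_succ, List.foldr_cons, List.foldr_cons,
      ← ih (fun i => E i.succ) (fun i => m i.succ) fun i => hm i.succ]
    exact act_apply_face_eq hv hL hX (E 0) (hm 0) _

end Coefficients

/-! ### The surviving chain of faces and its lattice volume. -/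

section Chain

variable {n : ℕ}

/-- The indices `≥ k`. -/
def upFrom (n k : ℕ) : Finset (Fin n) := Finset.univ.filter fun i => k ≤ (i : ℕ)

lemma mem_upFrom {k : ℕ} {i : Fin n} : i ∈ upFrom n k ↔ k ≤ (i : ℕ) := by simp [upFrom]

lemma upFrom_erase (i : Fin n) : (upFrom n i).erase i = upFrom n (i + 1) := by
  ext j
  rw [Finset.mem_erase, mem_upFrom, mem_upFrom, ne_eq, Fin.ext_iff]
  omega

variable {N : Type*} [AddCommGroup N] {Δ : Fan N} {v : Module.Basis (Fin n) ℚ (NQ N)}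
  (hv : ∀ S, faceCone v S ∈ Δ.cones)
  [Module.Finite ℤ N] {L : CompleteFlag ℚ (MQ N)} (hL : L.IsGeneric Δ)

/-- If `t i` vanishes on all `v j`, `j ≠ i`, then a single chain of faces contributes to the product
of the `t i`. -/
lemma foldr_drop_faceAct (c : Finset (Fin n) → Fin n → ℚ) {t : Fin n → MQ N}
    (ht : ∀ i j, j ≠ i → t i (v j) = 0) {k : ℕ} (hk : k ≤ n) (J : Finset (Fin n)) :
    (((List.finRange n).drop k).map t).foldr (faceAct c (projCoord hL hv))
        (fun J => if J = ∅ then 1 else 0) J =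
      if J = upFrom n k then ∏ i ∈ upFrom n k, c (upFrom n i) i * t i (v i) else 0 := by
  induction hk using Nat.decreasingInduction generalizing J with
  | self =>
    have h : upFrom n n = ∅ := by
      ext i
      simp [mem_upFrom]
    simp [h, List.drop_eq_nil_of_le]
  | of_succ k hk ih =>
    rw [List.drop_eq_getElem_cons (by simpa using hk), List.map_cons, List.foldr_cons]
    simp only [List.getElem_finRange]
    set i : Fin n := Fin.cast (by simp) (⟨k, by simpa using hk⟩ : Fin (List.finRange n).length)
      with hi
    have hik : (i : ℕ) = k := rfl
    have hup : (upFrom n k).erase i = upFrom n (k + 1) := upFrom_erase i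
    have hmem : i ∈ upFrom n k := mem_upFrom.2 le_rfl
    have hterm : ∀ j ∈ J, (j ≠ i ∨ J ≠ upFrom n k) →
        projCoord hL hv (J.erase j) j (t i) *
          (if J.erase j = upFrom n (k + 1) then
            ∏ i ∈ upFrom n (k + 1), c (upFrom n i) i * t i (v i) else 0) = 0 := by
      intro j hj hor
      split_ifs with hJ
      · by_cases hji : j = i
        · refine absurd ?_ (hor.resolve_left (not_not.2 hji))
          rw [← Finset.insert_erase hj, hJ, ← Finset.insert_erase hmem, hup, hji]
        -- Here `t i` annihilates the smaller face, so the projection fixes it; it then vanishes on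
        -- the added ray `v j` unless `j = i`.
        · have h1 : t i ∈ perp (faceCone v (J.erase j)) := by
            rw [mem_perp_faceCone, hJ, ← hup]
            exact fun l hl => ht i l (Finset.ne_of_mem_erase hl)
          rw [projCoord_of_mem_perp hL hv j h1, ht i j hji, zero_mul]
      · rw [mul_zero]
    rw [faceAct]
    simp only [ih]
    split_ifs with hJ
    · subst hJ
      rw [Finset.sum_eq_single i, if_pos hup, ← Finset.mul_prod_erase _ _ hmem, hup,
        projCoord_of_mem_perp hL hv]
      · rfl
      · rw [mem_perp_faceCone]
        intro l hl
        refine ht i l ?_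
        rintro rfl
        rw [mem_upFrom] at hl
        omega
      · intro j hj hji
        rw [mul_assoc, hterm j hj (Or.inl hji), mul_zero]
      · exact fun h => absurd hmem h
    · refine Finset.sum_eq_zero fun j hj => ?_
      rw [mul_assoc, hterm j hj (Or.inr hJ), mul_zero]

variable [Module.Free ℤ N]

omit [Module.Finite ℤ N] in
lemma eq_zero_of_latticeCoord_eq_zero {y : N} (h : ∀ l, latticeCoord v l y = 0) : y = 0 := by
  have h1 : (1 : ℚ) ⊗ₜ[ℤ] y = 0 := by
    rw [tmul_eq_sum_latticeCoord v (S := ∅) fun l _ => h l, Finset.sum_empty]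
  let b := Module.Free.chooseBasis ℤ N
  refine b.repr.map_eq_zero_iff.1 (Finsupp.ext fun i => ?_)
  have h2 := Algebra.TensorProduct.basis_repr_tmul (A := ℚ) b 1 y
  rw [h1, map_zero] at h2
  simpa using (DFunLike.congr_fun h2 i).symm

-- Along the descending chain of faces each successive lattice quotient is generated by the
-- corresponding first lattice point.
omit [Module.Finite ℤ N] in
lemma span_chain_eq_top {u : Fin n → N} (hu : ∀ i, v i = (1 : ℚ) ⊗ₜ[ℤ] u i)
    {X : Finset (Fin n) → Fin n → N} (hX : IsLatticeSystem v X) :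
    ⊤ ≤ Submodule.span ℤ (Set.range fun i : Fin n => X (upFrom n i) i) := by
  have key : ∀ k, k ≤ n → latticeSpan (faceCone v (upFrom n k)) ≤
      Submodule.span ℤ (Set.range fun i : Fin n => X (upFrom n i) i) := by
    intro k hk
    induction hk using Nat.decreasingInduction with
    | self =>
      intro y hy
      rw [eq_zero_of_latticeCoord_eq_zero (v := v) fun l =>
        latticeCoord_of_mem_latticeSpan v hy (by simp [mem_upFrom])]
      exact Submodule.zero_mem _
    | of_succ k hk ih =>
      intro y hy
      obtain ⟨a, -, ha⟩ := hX.exists_sub_zsmul_mem hu (J := upFrom n k) (j := ⟨k, hk⟩)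
        (mem_upFrom.2 le_rfl) hy
      have h1 : (upFrom n k).erase ⟨k, hk⟩ = upFrom n (k + 1) := upFrom_erase ⟨k, hk⟩
      rw [h1] at ha
      have h2 := Submodule.add_mem _ (ih ha)
        (Submodule.smul_mem _ a (Submodule.subset_span ⟨(⟨k, hk⟩ : Fin n), rfl⟩))
      rwa [sub_add_cancel] at h2
  refine le_trans ?_ (key 0 (Nat.zero_le n))
  intro y _
  rw [mem_latticeSpan_faceCone v hu]
  intro l hl
  exact absurd (mem_upFrom.2 (Nat.zero_le _)) hl

/-- In the lattice basis given by the chain the pairing matrix is triangular, since `X (upFrom n i)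
i` has no coordinates below `i`. -/
lemma latticeVolume_eq_abs_prod_div_factorial (hn : Module.finrank ℤ N = n) {u : Fin n → N}
    (hu : ∀ i, v i = (1 : ℚ) ⊗ₜ[ℤ] u i) {X : Finset (Fin n) → Fin n → N}
    (hX : IsLatticeSystem v X) {t : Fin n → MQ N} (ht : ∀ i j, j ≠ i → t i (v j) = 0) :
    latticeVolume hn (Fin.cons 0 t) =
      |∏ i, latticeCoord v i (X (upFrom n i) i) * t i (v i)| / n.factorial := by
  let b : Module.Basis (Fin n) ℤ N :=
    basisOfTopLeSpanOfCardEqFinrank _ (span_chain_eq_top hu hX) (by rw [Fintype.card_fin, hn])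
  have hb : ∀ i, b i = X (upFrom n i) i := fun i => by
    simp only [b, coe_basisOfTopLeSpanOfCardEqFinrank]
  have hentry : ∀ i j : Fin n, t j ((1 : ℚ) ⊗ₜ[ℤ] b i) =
      latticeCoord v j (X (upFrom n i) i) * t j (v j) := by
    intro i j
    rw [hb, tmul_eq_sum_latticeCoord v (S := Finset.univ) fun l hl =>
      absurd (Finset.mem_univ l) hl, map_sum, Finset.sum_eq_single j]
    · rw [map_smul, smul_eq_mul]
    · intro l _ hl
      rw [map_smul, ht j l hl, smul_zero]
    · exact fun h => absurd (Finset.mem_univ j) h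
  rw [latticeVolume_eq hn _ b, Matrix.det_of_isUpperTriangular]
  · simp [hentry]
  · intro i j hij
    simp only [Matrix.of_apply, Fin.cons_succ, Fin.cons_zero, sub_zero, hentry]
    rw [latticeCoord_of_mem_latticeSpan v (hX.mem (mem_upFrom.2 le_rfl)), zero_mul]
    rw [mem_upFrom]
    exact not_le.2 hij

end Chain

end ToricCycles

/-! ### The coefficient formula. -/

theorem corollary1 {N : Type*} [AddCommGroup N] [Module.Free ℤ N] [Module.Finite ℤ N]
    {n : ℕ} (hn : Module.finrank ℤ N = n)
    (Δ : Fan N)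
    -- a complete flag in `M_ℚ`, generic with respect to the fan
    (L : CompleteFlag ℚ (MQ N)) (hL : L.IsGeneric Δ)
    -- an `n`-dimensional simplicial cone
    (σ : Δ.cones) (hdim : dim (σ : Cone N) = n) (hsimp : (σ : Cone N).IsSimplicial)
    -- divisors, with local equations `m i` on `σ`
    (E : Fin n → QCartierDivisor Δ) (m : Fin n → MQ N)
    (hm : ∀ i, (E i).localEq σ = Submodule.Quotient.mk (m i))
    -- a non-zero vector perpendicular to `L_{n-1}`
    (w : NQ N) (hw : w ≠ 0) (hwL : ∀ l ∈ L.F (n - 1), l w = 0)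
    -- the facets of `σ`
    (τ : Fin n → Cone N) (hτ_inj : Function.Injective τ)
    (hτ : ∀ γ : Cone N, IsFacet γ σ ↔ ∃ i, τ i = γ)
    -- points on the extreme rays of the dual cone spanning a simplex of lattice volume `1 / n!`
    (t : Fin n → MQ N) (ht : ∀ i, t i ∈ dualFace (σ : Cone N) (τ i))
    (hvol : latticeVolume hn (Fin.cons 0 t) = 1 / (n.factorial : ℚ)) :
    (∀ i, t i w ≠ 0) ∧
      (L.complements hL).prod E σ = (∏ i, m i w) / (∏ i, t i w) := by
  obtain ⟨v, u, hu, hσ, hτv⟩ := exists_adapted_basis hn hdim hsimp hτ_inj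
    fun i => (hτ _).2 ⟨i, rfl⟩
  obtain ⟨σ, hσΔ⟩ := σ
  dsimp only at hσ hm ht
  subst hσ
  have hv : ∀ S, faceCone v S ∈ Δ.cones := fun S =>
    Δ.face_mem _ hσΔ _ (isFaceOf_faceCone v (Finset.subset_univ S))
  obtain ⟨X, hX⟩ := exists_isLatticeSystem v hu
  have ht0 : ∀ i j, j ≠ i → t i (v j) = 0 := by
    intro i j hji
    have h : t i ∈ perp (τ i) := (ht i).1
    rw [hτv, mem_perp_faceCone] at h
    exact h j (Finset.mem_erase.2 ⟨hji, Finset.mem_univ j⟩)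
  have htnn : ∀ i, 0 ≤ t i (v i) := fun i =>
    (ht i).2 ((basis_mem_faceCone v).2 (Finset.mem_univ i))
  set c : Finset (Fin n) → Fin n → ℚ := fun J j => latticeCoord v j (X J j) with hc
  -- The absolute value in the volume is harmless: `t i` lies in the dual cone and the lattice
  -- coordinates are positive.
  have hone : ∏ i : Fin n, c (upFrom n i) i * t i (v i) = 1 := by
    have h := latticeVolume_eq_abs_prod_div_factorial hn hu hX ht0
    rw [hvol, div_left_inj' (by positivity), abs_of_nonneg] at h
    · exact h.symm
    · exact Finset.prod_nonneg fun i _ =>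
        mul_nonneg (hX.pos (mem_upFrom.2 le_rfl)).le (htnn i)
  have hcomm := faceAct_comm (c := c) (ℓ := projCoord hL hv)
    (fun J a b ha hb hab => hX.mul_comm hu ha hb hab)
    (fun J a b ha hb hab => projCoord_exchange hL hv ha hb hab)
  obtain ⟨e, he⟩ := exists_projCoord_univ hL hv (Fintype.card_fin n) hw hwL
  have htop : ∀ m f, faceAct c (projCoord hL hv) m f Finset.univ =
      m w * faceAct c (projCoord hL hv) e f Finset.univ := by
    intro m f
    simp only [faceAct, Finset.mul_sum]
    refine Finset.sum_congr rfl fun j _ => ?_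
    rw [he j m]
    ring
  -- The factor involving `e` is the same for every family `s`; it is applied to both `t` and `m`.
  have hfold := fun s : Fin n → MQ N => foldr_faceAct_top hcomm (w := fun m => m w) htop
    (List.ofFn s) (fun J => if J = ∅ then 1 else 0)
  simp only [List.map_ofFn, List.prod_ofFn, List.length_ofFn, Function.comp_apply] at hfold
  have ht1 := foldr_drop_faceAct hv hL c ht0 (Nat.zero_le n) Finset.univ
  have huniv : upFrom n 0 = Finset.univ := by ext; simp [mem_upFrom]
  rw [List.drop_zero, ← List.ofFn_eq_map, huniv, if_pos rfl, hone, hfold t] at ht1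
  have hne : ∏ i, t i w ≠ 0 := left_ne_zero_of_mul_eq_one ht1
  refine ⟨fun i => Finset.prod_ne_zero_iff.1 hne i (Finset.mem_univ i), ?_⟩
  rw [eq_div_iff hne]
  have hprod := congrFun (prod_apply_face hv hL hX E m hm) Finset.univ
  rw [hprod, hfold m, mul_assoc, mul_comm _ (∏ i, t i w), ht1, mul_one]
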